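/- Let $\theta\in(0,\pi/2)$ and $\alpha>0$. Let $\Gamma\subset\mathbb R^2$ be the broken line $\Gamma=\overline{\{(t,t\tan\theta):t>0\}\cup\{(t,-t\tan\theta):t>0\}}$, and let $H(\theta,\alpha)=-\Delta-\alpha\delta_\Gamma$ be the self-adjoint operator in $L^2(\mathbb R^2)$ associated with the closed, lower semibounded quadratic form $$u\mapsto\iint_{\mathbb R^2}|\nabla u|^2\,dx-\alpha\int_\Gamma|u|^2\,ds,\qquad u\in H^1(\mathbb R^2),$$ where $u|_\Gamma$ is understood as a trace and $ds$ is the one-dimensional Hausdorff measure. Then $H(\theta,\alpha)$ has a lowest eigenvalue $\lambda(\theta,\alpha)$, and it satisfies $$\lambda(\theta,\alpha)\le-\alpha^2\Big(\frac14+\Lambda(\theta)\Big),$$ where $$\Lambda(\theta):=\frac{3\cos^6\theta\,\big(2^{2\cos^2\theta}-1\big)^2}{2\,(1+2\cos^2\theta)^3\,\big(108+180\cos^2\theta-132\cos^4\theta+45\cos^6\theta-5\cos^8\theta\big)}$$ is strictly positive. -/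

import Mathlib

open MeasureTheory Filter Topology
open scoped ContDiff

noncomputable section

namespace BrokenLine

/-- The Euclidean plane `ℝ²`. -/
abbrev Plane : Type := EuclideanSpace ℝ (Fin 2)

/-- The complex Hilbert space `L²(ℝ²)`. -/
abbrev L2Plane : Type := Lp ℂ 2 (volume : Measure Plane)

/-- The open ray `{(t, s t tan θ) : t > 0}`; the sign `s` is `1` or `-1` below. -/
def ray (θ s : ℝ) : Set Plane := {x | ∃ t : ℝ, 0 < t ∧ x = !₂[t, s * (t * Real.tan θ)]}

/-- The broken line `Γ`: the closure of the union of the two rays. -/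
def brokenLine (θ : ℝ) : Set Plane := closure (ray θ 1 ∪ ray θ (-1))

/-- The arc length measure on `Γ`: the one-dimensional Hausdorff measure restricted to `Γ`. -/
def arcLength (θ : ℝ) : Measure Plane := (Measure.hausdorffMeasure 1).restrict (brokenLine θ)

/-- The complex Hilbert space `L²(Γ, ds)`. -/
abbrev L2Line (θ : ℝ) : Type := Lp ℂ 2 (arcLength θ)

/-- Test functions: smooth complex-valued functions on the plane with compact support. -/
structure IsTest (φ : Plane → ℂ) : Prop where
  smooth : ContDiff ℝ ∞ φ
  compact : HasCompactSupport φ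

/-- The classical partial derivative in the `j`-th coordinate direction. -/
def pderiv (j : Fin 2) (φ : Plane → ℂ) (x : Plane) : ℂ :=
  fderiv ℝ φ x (EuclideanSpace.single j 1)

/-- `G` is the weak gradient of `u`, and `G` is square integrable: thus `u ∈ H¹(ℝ²)` holds
exactly when such a `G` exists, and `G` is then unique. -/
def IsWeakGradient (u : L2Plane) (G : Fin 2 → L2Plane) : Prop :=
  ∀ j : Fin 2, ∀ φ : Plane → ℂ, IsTest φ →
    ∫ x, u x * pderiv j φ x = - ∫ x, G j x * φ x

/-- `τ` is the trace on `Γ` of the function `u ∈ H¹(ℝ²)` with weak gradient `G`: some sequence of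
test functions tends to `u` in `H¹(ℝ²)` while its restrictions to `Γ` tend to `τ` in `L²(Γ, ds)`.
(As test functions are dense in `H¹(ℝ²)` and restriction to `Γ` is bounded from `H¹(ℝ²)` to
`L²(Γ, ds)`, every `u ∈ H¹(ℝ²)` has exactly one trace.) -/
def IsTrace (θ : ℝ) (u : L2Plane) (G : Fin 2 → L2Plane) (τ : L2Line θ) : Prop :=
  ∃ φ : ℕ → Plane → ℂ, (∀ k, IsTest (φ k)) ∧
    Tendsto (fun k => eLpNorm (fun x => φ k x - u x) 2 volume) atTop (𝓝 0) ∧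
    (∀ j, Tendsto (fun k => eLpNorm (fun x => pderiv j (φ k) x - G j x) 2 volume) atTop (𝓝 0)) ∧
    Tendsto (fun k => eLpNorm (fun x => φ k x - τ x) 2 (arcLength θ)) atTop (𝓝 0)

/-- `u` lies in the form domain `H¹(ℝ²)`, with weak gradient `G` and trace `τ` on `Γ`. -/
def InFormDomain (θ : ℝ) (u : L2Plane) (G : Fin 2 → L2Plane) (τ : L2Line θ) : Prop :=
  IsWeakGradient u G ∧ IsTrace θ u G τ

/-- The sesquilinear form (antilinear in the first argument) of the quadratic form
`u ↦ ∬ |∇u|² dx - α ∫_Γ |u|² ds`, written in terms of the gradients `G`, `G'` and the traces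
`τ`, `τ'` of the two functions of `H¹(ℝ²)`. -/
def form (θ α : ℝ) (G : Fin 2 → L2Plane) (τ : L2Line θ) (G' : Fin 2 → L2Plane) (τ' : L2Line θ) :
    ℂ :=
  (∑ j : Fin 2, inner ℂ (G j) (G' j)) - (α : ℂ) * inner ℂ τ τ'

theorem IsTest.zero : IsTest (fun _ => 0) := ⟨contDiff_const, HasCompactSupport.zero⟩

theorem IsTest.add {φ ψ : Plane → ℂ} (h : IsTest φ) (h' : IsTest ψ) :
    IsTest (fun x => φ x + ψ x) := ⟨h.smooth.add h'.smooth, h.compact.add h'.compact⟩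

theorem IsTest.const_mul {φ : Plane → ℂ} (c : ℂ) (h : IsTest φ) :
    IsTest (fun x => c * φ x) := ⟨contDiff_const.mul h.smooth, h.compact.mul_left⟩

theorem IsTest.differentiable {φ : Plane → ℂ} (h : IsTest φ) : Differentiable ℝ φ :=
  h.smooth.differentiable (by simp)

theorem IsTest.continuous_pderiv {φ : Plane → ℂ} (h : IsTest φ) (j : Fin 2) :
    Continuous (pderiv j φ) :=
  (h.smooth.continuous_fderiv (by simp)).clm_apply continuous_const

theorem pderiv_zero (j : Fin 2) : pderiv j (fun _ => 0) = fun _ => 0 := by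
  funext x; simp [pderiv]

theorem pderiv_add {φ ψ : Plane → ℂ} (h : IsTest φ) (h' : IsTest ψ) (j : Fin 2) :
    pderiv j (fun x => φ x + ψ x) = fun x => pderiv j φ x + pderiv j ψ x := by
  funext x
  simp only [pderiv]
  rw [fderiv_fun_add (h.differentiable x) (h'.differentiable x)]
  rfl

theorem pderiv_const_mul {φ : Plane → ℂ} (c : ℂ) (h : IsTest φ) (j : Fin 2) :
    pderiv j (fun x => c * φ x) = fun x => c * pderiv j φ x := by
  funext x
  simp only [pderiv]
  rw [fderiv_const_mul (h.differentiable x)]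
  rfl

theorem IsTest.memLp {φ : Plane → ℂ} (h : IsTest φ) : MemLp φ 2 (volume : Measure Plane) :=
  h.smooth.continuous.memLp_of_hasCompactSupport h.compact

theorem IsTest.memLp_pderiv {φ : Plane → ℂ} (h : IsTest φ) (j : Fin 2) :
    MemLp (pderiv j φ) 2 (volume : Measure Plane) :=
  (h.continuous_pderiv j).memLp_of_hasCompactSupport (h.compact.fderiv_apply ℝ _)

theorem tendsto_sub_add {μ : Measure Plane} {a b : ℕ → Plane → ℂ} {f g : Lp ℂ 2 μ}
    (ha : ∀ k, Continuous (a k)) (hb : ∀ k, Continuous (b k))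
    (hf : Tendsto (fun k => eLpNorm (fun x => a k x - f x) 2 μ) atTop (𝓝 0))
    (hg : Tendsto (fun k => eLpNorm (fun x => b k x - g x) 2 μ) atTop (𝓝 0)) :
    Tendsto (fun k => eLpNorm (fun x => (a k x + b k x) - (f + g : Lp ℂ 2 μ) x) 2 μ)
      atTop (𝓝 0) := by
  have hs := hf.add hg
  rw [add_zero] at hs
  refine tendsto_of_tendsto_of_tendsto_of_le_of_le tendsto_const_nhds hs (fun _ => zero_le) ?_
  intro k
  have h1 : AEStronglyMeasurable (fun x => a k x - f x) μ :=
    (ha k).aestronglyMeasurable.sub (Lp.aestronglyMeasurable f)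
  have h2 : AEStronglyMeasurable (fun x => b k x - g x) μ :=
    (hb k).aestronglyMeasurable.sub (Lp.aestronglyMeasurable g)
  refine le_trans (le_of_eq ?_) (eLpNorm_add_le h1 h2 (by norm_num))
  refine eLpNorm_congr_ae ?_
  filter_upwards [Lp.coeFn_add f g] with x hx
  simp only [hx, Pi.add_apply]
  ring

theorem tendsto_sub_smul {μ : Measure Plane} {a : ℕ → Plane → ℂ} {f : Lp ℂ 2 μ} (c : ℂ)
    (hf : Tendsto (fun k => eLpNorm (fun x => a k x - f x) 2 μ) atTop (𝓝 0)) :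
    Tendsto (fun k => eLpNorm (fun x => c * a k x - (c • f : Lp ℂ 2 μ) x) 2 μ)
      atTop (𝓝 0) := by
  have hs := ENNReal.Tendsto.const_mul (a := ‖c‖ₑ) hf (Or.inr (by simp))
  rw [mul_zero] at hs
  refine hs.congr fun k => ?_
  rw [← eLpNorm_const_smul c]
  refine eLpNorm_congr_ae ?_
  filter_upwards [Lp.coeFn_smul c f] with x hx
  simp only [hx, Pi.smul_apply, smul_eq_mul]
  ring

theorem integrable_mul {μ : Measure Plane} {φ : Plane → ℂ} (f : Lp ℂ 2 μ) (h : MemLp φ 2 μ) :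
    Integrable (fun x => f x * φ x) μ :=
  (Lp.memLp f).integrable_mul h

theorem InFormDomain.zero (θ : ℝ) : InFormDomain θ 0 0 0 := by
  have key : ∀ μ : Measure Plane,
      eLpNorm (fun x => (0 : ℂ) - (0 : Lp ℂ 2 μ) x) 2 μ = 0 := by
    intro μ
    rw [← eLpNorm_zero (ε := ℂ) (p := 2) (μ := μ) (α := Plane)]
    refine eLpNorm_congr_ae ?_
    filter_upwards [Lp.coeFn_zero ℂ 2 μ] with x hx
    rw [hx]
    simp
  refine ⟨fun j φ _ => ?_, fun _ _ => 0, fun _ => IsTest.zero, ?_, fun j => ?_, ?_⟩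
  · have h1 : ∀ φ : Plane → ℂ, ∫ x, (0 : L2Plane) x * φ x = 0 := by
      intro φ
      refine integral_eq_zero_of_ae ?_
      filter_upwards [Lp.coeFn_zero ℂ 2 (volume : Measure Plane)] with x hx
      rw [hx]
      simp
    simp only [Pi.zero_apply, h1, neg_zero]
  · simp only [key]; exact tendsto_const_nhds
  · simp only [pderiv_zero, Pi.zero_apply, key]; exact tendsto_const_nhds
  · simp only [key]; exact tendsto_const_nhds

theorem InFormDomain.add {θ : ℝ} {u u' : L2Plane} {G G' : Fin 2 → L2Plane} {τ τ' : L2Line θ}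
    (h : InFormDomain θ u G τ) (h' : InFormDomain θ u' G' τ') :
    InFormDomain θ (u + u') (G + G') (τ + τ') := by
  obtain ⟨hw, φ, hφ, h1, h2, h3⟩ := h
  obtain ⟨hw', ψ, hψ, h1', h2', h3'⟩ := h'
  refine ⟨fun j χ hχ => ?_, fun k x => φ k x + ψ k x, fun k => (hφ k).add (hψ k), ?_, ?_, ?_⟩
  · have key : ∀ (f g : L2Plane) (η : Plane → ℂ), MemLp η 2 (volume : Measure Plane) →
        ∫ x, (f + g : L2Plane) x * η x = (∫ x, f x * η x) + ∫ x, g x * η x := by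
      intro f g η hη
      rw [← integral_add (integrable_mul f hη) (integrable_mul g hη)]
      refine integral_congr_ae ?_
      filter_upwards [Lp.coeFn_add f g] with x hx
      simp only [hx, Pi.add_apply]
      ring
    rw [Pi.add_apply, key _ _ _ (hχ.memLp_pderiv j), key _ _ _ hχ.memLp, hw j χ hχ, hw' j χ hχ]
    ring
  · exact tendsto_sub_add (fun k => (hφ k).smooth.continuous) (fun k => (hψ k).smooth.continuous)
      h1 h1'
  · intro j
    simp only [pderiv_add (hφ _) (hψ _) j]
    exact tendsto_sub_add (fun k => (hφ k).continuous_pderiv j)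
      (fun k => (hψ k).continuous_pderiv j) (h2 j) (h2' j)
  · exact tendsto_sub_add (fun k => (hφ k).smooth.continuous) (fun k => (hψ k).smooth.continuous)
      h3 h3'

theorem InFormDomain.smul {θ : ℝ} {u : L2Plane} {G : Fin 2 → L2Plane} {τ : L2Line θ} (c : ℂ)
    (h : InFormDomain θ u G τ) : InFormDomain θ (c • u) (c • G) (c • τ) := by
  obtain ⟨hw, φ, hφ, h1, h2, h3⟩ := h
  refine ⟨fun j χ hχ => ?_, fun k x => c * φ k x, fun k => (hφ k).const_mul c, ?_, ?_, ?_⟩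
  · have key : ∀ (f : L2Plane) (η : Plane → ℂ),
        ∫ x, (c • f : L2Plane) x * η x = c * ∫ x, f x * η x := by
      intro f η
      rw [← integral_const_mul]
      refine integral_congr_ae ?_
      filter_upwards [Lp.coeFn_smul c f] with x hx
      simp only [hx, Pi.smul_apply, smul_eq_mul]
      ring
    rw [Pi.smul_apply, key, key, hw j χ hχ]
    ring
  · exact tendsto_sub_smul c h1
  · intro j
    simp only [pderiv_const_mul c (hφ _) j]
    exact tendsto_sub_smul c (h2 j)
  · exact tendsto_sub_smul c h3

/-- The graph of the operator associated with the form: the pairs `(u, f)` with `u ∈ H¹(ℝ²)`,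
`f ∈ L²(ℝ²)` such that the form at `(v, u)` equals `⟨v, f⟩` for all `v ∈ H¹(ℝ²)`. -/
def operatorGraph (θ α : ℝ) : Submodule ℂ (L2Plane × L2Plane) where
  carrier := {p | ∃ (G : Fin 2 → L2Plane) (τ : L2Line θ), InFormDomain θ p.1 G τ ∧
    ∀ (v : L2Plane) (Gv : Fin 2 → L2Plane) (τv : L2Line θ), InFormDomain θ v Gv τv →
      form θ α Gv τv G τ = inner ℂ v p.2}
  zero_mem' := ⟨0, 0, InFormDomain.zero θ, fun v Gv τv _ => by simp [form]⟩
  add_mem' := by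
    rintro p q ⟨G, τ, h, hp⟩ ⟨G', τ', h', hq⟩
    refine ⟨G + G', τ + τ', h.add h', fun v Gv τv hv => ?_⟩
    rw [Prod.snd_add, inner_add_right, ← hp v Gv τv hv, ← hq v Gv τv hv]
    simp only [form, Pi.add_apply, inner_add_right, Finset.sum_add_distrib]
    ring
  smul_mem' := by
    rintro c p ⟨G, τ, h, hp⟩
    refine ⟨c • G, c • τ, h.smul c, fun v Gv τv hv => ?_⟩
    rw [Prod.smul_snd, inner_smul_right, ← hp v Gv τv hv]
    simp only [form, Pi.smul_apply, inner_smul_right, ← Finset.mul_sum]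
    ring

/-- The operator `H(θ, α) = -Δ - α δ_Γ` in `L²(ℝ²)`, an unbounded operator on its natural
domain: the operator associated with the form above. -/
def hamiltonian (θ α : ℝ) : L2Plane →ₗ.[ℂ] L2Plane := (operatorGraph θ α).toLinearPMap

/-- The set of eigenvalues of `H(θ, α)`, which are real. -/
def eigenvalues (θ α : ℝ) : Set ℝ :=
  {E | ∃ u : (hamiltonian θ α).domain, u ≠ 0 ∧ hamiltonian θ α u = (E : ℂ) • (u : L2Plane)}

/-- The explicit constant `Λ(θ)`. -/
def Lam (θ : ℝ) : ℝ :=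
  3 * Real.cos θ ^ 6 * ((2 : ℝ) ^ (2 * Real.cos θ ^ 2) - 1) ^ 2 /
    (2 * (1 + 2 * Real.cos θ ^ 2) ^ 3 *
      (108 + 180 * Real.cos θ ^ 2 - 132 * Real.cos θ ^ 4 + 45 * Real.cos θ ^ 6
        - 5 * Real.cos θ ^ 8))

end BrokenLine

end

/-!
Write `k = α / 2` and `T = tan θ`. The infimum `groundEnergy` of the Rayleigh quotients
over test functions is at most `-α² (1/4 + Λ(θ))`, hence less than `-k²`, and an infimum below `-k²`
is attained, because the form is bounded below by `-k²` up to a compact perturbation.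

**Lower bound.** On each line perpendicular to a ray, at distance `s` from the vertex, the one
dimensional Robin estimate `robin_estimate` bounds `2 k |u|²` on the ray, minus
`k exp (-k T s) |u|²`, by the integral of `|u'|² + k² |u|²` over the part of the line between the
axis of symmetry and infinity. These segments fill disjoint wedges. The remainder has the weight
`exp (-k T s)`, which is small far from the vertex; near the vertex the trace is approximated by
its means over small squares (`IsC1.trace_square`), that is, by finitely many linear functionals.
This gives `essential_lower_bound`.

**Existence.** Let `E` be the infimum and suppose `E < -k²`. The form minus `E ‖u‖²` is
nonnegative, so by the parallelogram law it is small on differences of members of a minimizing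
sequence. Together with the lower bound, once the finitely many functionals converge along a
subsequence, the sequence is Cauchy in `L²(ℝ²)`, then in `H¹(ℝ²)`, and its traces are Cauchy in
`L²(Γ)` (`exists_cauchy_minimizing`). The limit satisfies the Euler–Lagrange equation
(`form_eq_of_minimizer`), so it is an eigenfunction, and no eigenvalue lies below `E`.

**Upper bound.** Let `s` and `d` be the coordinates along and across the ray in the upper
half-plane, and extend by reflection. The trial function is `exp (-k (|d| + max (δ s) (-ρ s)))` with
`ρ = 1 / T` and `δ = cos⁴ θ T / 4`. For `δ = ρ = 0` its energy would be at the threshold `-k²`; a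
strong decay `ρ` behind the vertex gains more than the weak decay `δ` along the rays costs. All
integrals are explicit (`integral_kinetic_trial`, `integral_trace_trial`), and the resulting
inequality `trial_balance` holds already with `cos⁶ θ / 216` in place of `Λ(θ)`; Bernoulli's
inequality `4 ^ c ≤ 1 + 3 c` with `c = cos² θ` gives `Λ(θ) ≤ cos⁶ θ / 216` (`Lam_le`).
-/

noncomputable section

namespace BrokenLine

/-! ### Robin, Poincaré and trace estimates in a wedge -/

section

/-- The Robin estimate on the half-line `(-L, ∞)`. Each side of `0` contributes the integral of
`(ω |g|²)' ≤ |g'|² + (ω² + ω') |g|²` for a weight `ω` with `ω² + ω' ≤ k²`. -/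
theorem robin_estimate {g g' : ℝ → ℂ} (hg : ∀ d, HasDerivAt g (g' d) d) (hg' : Continuous g')
    (hc : HasCompactSupport g) {k L : ℝ} (hk : 0 < k) (hL : 0 ≤ L) :
    k * (2 - Real.exp (-(k * L))) * ‖g 0‖ ^ 2 ≤
      ∫ d in Set.Ioi (-L), (‖g' d‖ ^ 2 + k ^ 2 * ‖g d‖ ^ 2) := by
  have hgc : Continuous g := continuous_iff_continuousAt.2 fun d => (hg d).continuousAt
  have hg'eq : g' = deriv g := funext fun d => ((hg d).deriv).symm
  have hc' : HasCompactSupport g' := hg'eq ▸ hc.deriv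
  have hcont : Continuous fun d => ‖g' d‖ ^ 2 + k ^ 2 * ‖g d‖ ^ 2 := by fun_prop
  have hcs : HasCompactSupport fun d => ‖g' d‖ ^ 2 + k ^ 2 * ‖g d‖ ^ 2 :=
    (hc'.norm.comp_left (g := fun t : ℝ => t ^ 2) (by simp)).add
      ((hc.norm.comp_left (g := fun t : ℝ => k ^ 2 * t ^ 2) (by simp)))
  have hint := hcont.integrable_of_hasCompactSupport hcs (μ := volume)
  have hsq : ∀ d, HasDerivAt (fun d => ‖g d‖ ^ 2) (2 * inner ℝ (g d) (g' d)) d :=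
    fun d => (hg d).norm_sq
  -- the inequality `2 ω Re(ḡ g') ≤ |g'|² + ω² |g|²`
  have hyoung : ∀ (w : ℝ) (a b : ℂ), w * (2 * inner ℝ a b) ≤ ‖b‖ ^ 2 + w ^ 2 * ‖a‖ ^ 2 := by
    intro w a b
    have h3 : 0 ≤ (‖b‖ - |w| * ‖a‖) ^ 2 := sq_nonneg _
    have h4 : w * (2 * inner ℝ a b) ≤ 2 * (|w| * (‖a‖ * ‖b‖)) := by
      have h5 := abs_real_inner_le_norm a b
      calc w * (2 * inner ℝ a b) ≤ |w * (2 * inner ℝ a b)| := le_abs_self _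
        _ = 2 * (|w| * |inner ℝ a b|) := by rw [abs_mul, abs_mul]; norm_num; ring
        _ ≤ _ := by gcongr
    have h6 : |w| ^ 2 = w ^ 2 := sq_abs w
    nlinarith
  have hcinner : Continuous fun d => (inner ℝ (g d) (g' d) : ℝ) := hgc.inner hg'
  -- the outer half-line, with the constant weight `-k`
  have hout : k * ‖g 0‖ ^ 2 ≤ ∫ d in Set.Ioi (0 : ℝ), (‖g' d‖ ^ 2 + k ^ 2 * ‖g d‖ ^ 2) := by
    have hcs2 : HasCompactSupport fun d => -k * (2 * inner ℝ (g d) (g' d) : ℝ) := by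
      refine hc.mono' ?_
      intro x hx
      by_contra h
      exact hx (by simp [image_eq_zero_of_notMem_tsupport h])
    have hint2 : Integrable (fun d => -k * (2 * inner ℝ (g d) (g' d) : ℝ)) :=
      (by fun_prop : Continuous fun d => -k * (2 * inner ℝ (g d) (g' d) : ℝ))
        |>.integrable_of_hasCompactSupport hcs2
    have hlim : Tendsto (fun d => -k * ‖g d‖ ^ 2) atTop (𝓝 0) := by
      have h0 : HasCompactSupport fun d => -k * ‖g d‖ ^ 2 :=
        hc.norm.comp_left (g := fun t : ℝ => -k * t ^ 2) (by simp)
      exact h0.is_zero_at_infty.mono_left atTop_le_cocompact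
    have h1 := integral_Ioi_of_hasDerivAt_of_tendsto (a := 0) (m := 0)
      (f := fun d => -k * ‖g d‖ ^ 2) (f' := fun d => -k * (2 * inner ℝ (g d) (g' d)))
      (by fun_prop) (fun d _ => (hsq d).const_mul (-k)) hint2.integrableOn hlim
    have h2 : ∫ d in Set.Ioi (0 : ℝ), -k * (2 * inner ℝ (g d) (g' d)) ≤
        ∫ d in Set.Ioi (0 : ℝ), (‖g' d‖ ^ 2 + k ^ 2 * ‖g d‖ ^ 2) := by
      refine integral_mono hint2.integrableOn hint.integrableOn fun d => ?_
      have := hyoung (-k) (g d) (g' d)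
      simpa using this
    rw [h1] at h2
    linarith
  -- the inner segment, with the weight `k (1 - exp (-k (d + L)))`
  have hin : k * (1 - Real.exp (-(k * L))) * ‖g 0‖ ^ 2 ≤
      ∫ d in Set.Ioc (-L) 0, (‖g' d‖ ^ 2 + k ^ 2 * ‖g d‖ ^ 2) := by
    set E : ℝ → ℝ := fun d => Real.exp (-(k * (d + L))) with hE
    have hEd : ∀ d, HasDerivAt E (-k * E d) d := by
      intro d
      have h : HasDerivAt (fun d : ℝ => -(k * (d + L))) (-(k * 1)) d :=
        (((hasDerivAt_id d).add_const L).const_mul k).neg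
      refine h.exp.congr_deriv ?_
      change Real.exp _ * _ = -k * Real.exp _
      rw [mul_one, mul_comm]
    have hEc : Continuous E := by fun_prop
    have hder : ∀ d, HasDerivAt (fun d => k * (1 - E d) * ‖g d‖ ^ 2)
        (k * (k * E d) * ‖g d‖ ^ 2 + k * (1 - E d) * (2 * inner ℝ (g d) (g' d))) d := by
      intro d
      exact ((((hEd d).const_sub 1).const_mul k).mul (hsq d)).congr_deriv (by ring)
    have hcd : Continuous fun d =>
        k * (k * E d) * ‖g d‖ ^ 2 + k * (1 - E d) * (2 * inner ℝ (g d) (g' d)) := by fun_prop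
    have h1 := intervalIntegral.integral_eq_sub_of_hasDerivAt (a := -L) (b := 0)
      (fun d _ => hder d) (hcd.intervalIntegrable _ _)
    have h2 : ∫ d in (-L)..0, (k * (k * E d) * ‖g d‖ ^ 2 +
          k * (1 - E d) * (2 * inner ℝ (g d) (g' d))) ≤
        ∫ d in (-L)..0, (‖g' d‖ ^ 2 + k ^ 2 * ‖g d‖ ^ 2) := by
      refine intervalIntegral.integral_mono_on (by linarith) (hcd.intervalIntegrable _ _)
        (hcont.intervalIntegrable _ _) fun d hd => ?_
      have h3 := hyoung (k * (1 - E d)) (g d) (g' d)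
      have h4 : 0 ≤ E d := (Real.exp_pos _).le
      have h5 : E d ≤ 1 := Real.exp_le_one_iff.2 (by nlinarith [hd.1])
      have h6 : 0 ≤ k ^ 2 * ‖g d‖ ^ 2 * (E d * (1 - E d)) := by
        have : 0 ≤ 1 - E d := by linarith
        positivity
      nlinarith
    rw [h1, intervalIntegral.integral_of_le (by linarith)] at h2
    simpa [hE] using h2
  have hsplit : Set.Ioi (-L) = Set.Ioc (-L) 0 ∪ Set.Ioi 0 :=
    (Set.Ioc_union_Ioi_eq_Ioi (by linarith)).symm
  rw [hsplit, setIntegral_union (Set.Ioc_disjoint_Ioi le_rfl) measurableSet_Ioi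
    hint.integrableOn hint.integrableOn]
  linarith

/-- Cauchy–Schwarz on an interval. -/
theorem norm_sq_intervalIntegral_le {f : ℝ → ℂ} (hf : Continuous f) {a b : ℝ} (hab : a < b) :
    ‖∫ x in a..b, f x‖ ^ 2 ≤ (b - a) * ∫ x in a..b, ‖f x‖ ^ 2 := by
  set I := ∫ x in a..b, ‖f x‖ with hI
  have h1 : ‖∫ x in a..b, f x‖ ≤ I := intervalIntegral.norm_integral_le_integral_norm hab.le
  have h2 : 0 ≤ ∫ x in a..b, ((b - a) * ‖f x‖ - I) ^ 2 :=
    intervalIntegral.integral_nonneg hab.le fun _ _ => sq_nonneg _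
  have h3 : ∫ x in a..b, ((b - a) * ‖f x‖ - I) ^ 2 =
      (b - a) ^ 2 * (∫ x in a..b, ‖f x‖ ^ 2) - (2 * (b - a) * I) * I + (b - a) * I ^ 2 := by
    have e : ∀ x, ((b - a) * ‖f x‖ - I) ^ 2 =
        (b - a) ^ 2 * ‖f x‖ ^ 2 - (2 * (b - a) * I) * ‖f x‖ + I ^ 2 := fun x => by ring
    simp only [e]
    rw [intervalIntegral.integral_add, intervalIntegral.integral_sub,
      intervalIntegral.integral_const_mul, intervalIntegral.integral_const_mul,
      intervalIntegral.integral_const, smul_eq_mul]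
    all_goals exact Continuous.intervalIntegrable (by fun_prop) _ _
  have h4 : ‖∫ x in a..b, f x‖ ^ 2 ≤ I ^ 2 := by gcongr
  have h5 : 0 < b - a := by linarith
  rw [h3] at h2
  nlinarith

/-- One-dimensional Poincaré inequality with point evaluation. -/
theorem norm_sub_average_sq_le {f f' : ℝ → ℂ} (hf : ∀ x, HasDerivAt f (f' x) x)
    (hf' : Continuous f') {a h x : ℝ} (hh : 0 < h) (hx : x ∈ Set.Icc a (a + h)) :
    ‖h * f x - ∫ y in a..(a + h), f y‖ ^ 2 ≤ h ^ 3 * ∫ y in a..(a + h), ‖f' y‖ ^ 2 := by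
  have hfc : Continuous f := continuous_iff_continuousAt.2 fun d => (hf d).continuousAt
  have h0 : (h : ℂ) * f x - ∫ y in a..(a + h), f y = ∫ y in a..(a + h), (f x - f y) := by
    rw [intervalIntegral.integral_sub (by simp) (hfc.intervalIntegrable _ _),
      intervalIntegral.integral_const]
    simp
  have hbd : ∀ y ∈ Set.Icc a (a + h), ‖f x - f y‖ ≤ ∫ z in a..(a + h), ‖f' z‖ := by
    intro y hy
    rw [← intervalIntegral.integral_eq_sub_of_hasDerivAt (fun z _ => hf z)
      (hf'.intervalIntegrable y x)]
    refine (intervalIntegral.norm_integral_le_abs_integral_norm).trans ?_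
    rw [intervalIntegral.integral_of_le (by linarith : a ≤ a + h),
      intervalIntegral.abs_intervalIntegral_eq,
      abs_of_nonneg (integral_nonneg fun _ => norm_nonneg _)]
    refine setIntegral_mono_set ?_ (ae_of_all _ fun _ => norm_nonneg _) ?_
    · exact (hf'.norm.integrableOn_Icc (a := a) (b := a + h)).mono_set Set.Ioc_subset_Icc_self
    · exact LE.le.eventuallyLE <| Set.Ioc_subset_Ioc (le_min hy.1 hx.1) (max_le hy.2 hx.2)
  set I := ∫ z in a..(a + h), ‖f' z‖ with hI
  have h1 : ‖∫ y in a..(a + h), (f x - f y)‖ ≤ I * |a + h - a| :=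
    intervalIntegral.norm_integral_le_of_norm_le_const fun y hy => by
      rw [Set.uIoc_of_le (by linarith)] at hy
      exact hbd y ⟨hy.1.le, hy.2⟩
  rw [add_sub_cancel_left, abs_of_pos hh] at h1
  have hI0 : 0 ≤ I := intervalIntegral.integral_nonneg (by linarith) fun _ _ => norm_nonneg _
  have h2 := norm_sq_intervalIntegral_le (f := fun z => (‖f' z‖ : ℂ)) (by fun_prop)
    (by linarith : a < a + h)
  rw [intervalIntegral.integral_ofReal] at h2
  simp only [Complex.norm_real, norm_norm, add_sub_cancel_left] at h2
  rw [← hI, Real.norm_of_nonneg hI0] at h2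
  rw [h0]
  calc _ ≤ (I * h) ^ 2 := by gcongr
    _ = h ^ 2 * I ^ 2 := by ring
    _ ≤ h ^ 2 * (h * ∫ y in a..(a + h), ‖f' y‖ ^ 2) := by gcongr
    _ = _ := by ring

/-- The part of the plane in which a point with coordinates `(s, d)` has `s ∈ S` and lies above
the line `d = -T s`. -/
def wedge (T : ℝ) (S : Set ℝ) : Set (ℝ × ℝ) := {p | p.1 ∈ S ∧ -(T * p.1) < p.2}

theorem measurableSet_wedge (T : ℝ) {S : Set ℝ} (hS : MeasurableSet S) :
    MeasurableSet (wedge T S) :=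
  (measurable_fst hS).inter
    (measurableSet_lt (measurable_fst.const_mul T).neg measurable_snd)

theorem setIntegral_wedge (T : ℝ) {S : Set ℝ} (hS : MeasurableSet S) {G : ℝ × ℝ → ℝ}
    (hG : IntegrableOn G (wedge T S)) :
    ∫ p in wedge T S, G p = ∫ s in S, ∫ d in Set.Ioi (-(T * s)), G (s, d) := by
  have hm := measurableSet_wedge T hS
  rw [← integral_indicator hm, Measure.volume_eq_prod, integral_prod _
    ((integrable_indicator_iff hm).2 hG), ← integral_indicator hS]
  congr 1
  funext s
  by_cases hs : s ∈ S
  · rw [Set.indicator_of_mem hs, ← integral_indicator measurableSet_Ioi]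
    congr 1
    funext d
    simp [Set.indicator, wedge, hs]
  · rw [Set.indicator_of_notMem hs]
    simp [Set.indicator, wedge, hs]

theorem integrableOn_setIntegral_wedge (T : ℝ) {S : Set ℝ} (hS : MeasurableSet S) {G : ℝ × ℝ → ℝ}
    (hG : IntegrableOn G (wedge T S)) :
    IntegrableOn (fun s => ∫ d in Set.Ioi (-(T * s)), G (s, d)) S := by
  have hm := measurableSet_wedge T hS
  have h := ((integrable_indicator_iff hm).2 hG)
  rw [Measure.volume_eq_prod] at h
  rw [← integrable_indicator_iff hS]
  refine h.integral_prod_left.congr (ae_of_all _ fun s => ?_)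
  change ∫ d, (wedge T S).indicator G (s, d) = _
  by_cases hs : s ∈ S
  · rw [Set.indicator_of_mem hs, ← integral_indicator measurableSet_Ioi]
    congr 1
    funext d
    simp [Set.indicator, wedge, hs]
  · rw [Set.indicator_of_notMem hs]
    simp [Set.indicator, wedge, hs]

/-- A compactly supported function of two variables `(s, d)` with continuous first derivatives
`ψs` and `ψd`. -/
structure IsC1 (ψ ψs ψd : ℝ × ℝ → ℂ) : Prop where
  compact : HasCompactSupport ψ
  cont : Continuous ψ
  cont_s : Continuous ψs
  cont_d : Continuous ψd
  deriv_s : ∀ s d, HasDerivAt (fun s => ψ (s, d)) (ψs (s, d)) s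
  deriv_d : ∀ s d, HasDerivAt (fun d => ψ (s, d)) (ψd (s, d)) d

namespace IsC1

variable {ψ ψs ψd : ℝ × ℝ → ℂ}

theorem compact_left (h : IsC1 ψ ψs ψd) (d : ℝ) : HasCompactSupport fun s => ψ (s, d) :=
  h.compact.comp_isClosedEmbedding (g := fun s : ℝ => (s, d))
    (Topology.IsClosedEmbedding.of_continuous_injective_isClosedMap (by fun_prop)
      (fun a b hab => (Prod.ext_iff.1 hab).1)
      (isClosedMap_prodMk_right d))

theorem compact_right (h : IsC1 ψ ψs ψd) (s : ℝ) : HasCompactSupport fun d => ψ (s, d) :=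
  h.compact.comp_isClosedEmbedding (g := fun d : ℝ => (s, d))
    (Topology.IsClosedEmbedding.of_continuous_injective_isClosedMap (by fun_prop)
      (fun a b hab => (Prod.ext_iff.1 hab).2)
      (isClosedMap_prodMk_left s))

theorem compact_s (h : IsC1 ψ ψs ψd) : HasCompactSupport ψs := by
  refine h.compact.mono' fun p hp => ?_
  by_contra hn
  refine hp ?_
  have h0 : ψ =ᶠ[𝓝 p] 0 := notMem_tsupport_iff_eventuallyEq.1 hn
  have h1 : (fun s => ψ (s, p.2)) =ᶠ[𝓝 p.1] fun _ => 0 :=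
    (by fun_prop : Continuous fun s : ℝ => (s, p.2)).continuousAt (x := p.1) |>.eventually h0
  exact (h.deriv_s p.1 p.2).unique ((hasDerivAt_const p.1 (0 : ℂ)).congr_of_eventuallyEq h1)

theorem compact_d (h : IsC1 ψ ψs ψd) : HasCompactSupport ψd := by
  refine h.compact.mono' fun p hp => ?_
  by_contra hn
  refine hp ?_
  have h0 : ψ =ᶠ[𝓝 p] 0 := notMem_tsupport_iff_eventuallyEq.1 hn
  have h1 : (fun d => ψ (p.1, d)) =ᶠ[𝓝 p.2] fun _ => 0 :=
    (by fun_prop : Continuous fun d : ℝ => (p.1, d)).continuousAt (x := p.2) |>.eventually h0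
  exact (h.deriv_d p.1 p.2).unique ((hasDerivAt_const p.2 (0 : ℂ)).congr_of_eventuallyEq h1)

theorem integrable_norm_sq {χ : ℝ × ℝ → ℂ} (hc : HasCompactSupport χ) (hχ : Continuous χ) :
    Integrable fun p => ‖χ p‖ ^ 2 :=
  (by fun_prop : Continuous fun p => ‖χ p‖ ^ 2).integrable_of_hasCompactSupport
    (hc.norm.comp_left (g := fun t : ℝ => t ^ 2) (by simp))

theorem integrable_trace (h : IsC1 ψ ψs ψd) : Integrable fun s => ‖ψ (s, 0)‖ ^ 2 :=
  (by have := h.cont; fun_prop : Continuous fun s => ‖ψ (s, 0)‖ ^ 2).integrable_of_hasCompactSupport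
    ((h.compact_left 0).norm.comp_left (g := fun t : ℝ => t ^ 2) (by simp))

theorem integrable_exp_trace (h : IsC1 ψ ψs ψd) (c : ℝ) :
    Integrable fun s => Real.exp (-(c * s)) * ‖ψ (s, 0)‖ ^ 2 :=
  (by have := h.cont; fun_prop : Continuous fun s => Real.exp (-(c * s)) * ‖ψ (s, 0)‖ ^ 2)
    |>.integrable_of_hasCompactSupport
    ((h.compact_left 0).norm.comp_left (g := fun t : ℝ => t ^ 2) (by simp)).mul_left

/-- Robin estimate on every line perpendicular to the ray `d = 0`, integrated along the ray. -/
theorem robin (h : IsC1 ψ ψs ψd) {k T : ℝ} (hk : 0 < k) (hT : 0 ≤ T) :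
    k * (2 * (∫ s in Set.Ioi 0, ‖ψ (s, 0)‖ ^ 2) -
        ∫ s in Set.Ioi 0, Real.exp (-(k * T * s)) * ‖ψ (s, 0)‖ ^ 2) ≤
      (∫ p in wedge T (Set.Ioi 0), ‖ψd p‖ ^ 2) +
        k ^ 2 * ∫ p in wedge T (Set.Ioi 0), ‖ψ p‖ ^ 2 := by
  have i1 := integrable_norm_sq h.compact h.cont
  have i2 := integrable_norm_sq h.compact_d h.cont_d
  have i3 : Integrable fun p => ‖ψd p‖ ^ 2 + k ^ 2 * ‖ψ p‖ ^ 2 := i2.add (i1.const_mul _)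
  have e1 : (∫ p in wedge T (Set.Ioi 0), ‖ψd p‖ ^ 2) +
        k ^ 2 * ∫ p in wedge T (Set.Ioi 0), ‖ψ p‖ ^ 2 =
      ∫ p in wedge T (Set.Ioi 0), (‖ψd p‖ ^ 2 + k ^ 2 * ‖ψ p‖ ^ 2) := by
    rw [integral_add i2.integrableOn (i1.const_mul _).integrableOn, integral_const_mul]
  have e2 : k * (2 * (∫ s in Set.Ioi 0, ‖ψ (s, 0)‖ ^ 2) -
        ∫ s in Set.Ioi 0, Real.exp (-(k * T * s)) * ‖ψ (s, 0)‖ ^ 2) =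
      ∫ s in Set.Ioi 0, (k * (2 * ‖ψ (s, 0)‖ ^ 2 -
        Real.exp (-(k * T * s)) * ‖ψ (s, 0)‖ ^ 2)) := by
    rw [integral_const_mul, integral_sub (h.integrable_trace.const_mul 2).integrableOn
      (h.integrable_exp_trace _).integrableOn, integral_const_mul]
  rw [e1, e2, setIntegral_wedge T measurableSet_Ioi i3.integrableOn]
  refine setIntegral_mono_on
    (((h.integrable_trace.const_mul 2).sub (h.integrable_exp_trace _)).const_mul k).integrableOn
    (integrableOn_setIntegral_wedge T measurableSet_Ioi i3.integrableOn) measurableSet_Ioi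
    fun s hs => ?_
  have hs' : 0 < s := hs
  refine le_trans (le_of_eq ?_) (robin_estimate (h.deriv_d s)
    (by have := h.cont_d; fun_prop) (h.compact_right s) hk (mul_nonneg hT hs'.le))
  ring_nf

theorem _root_.Continuous.integrableOn_uIoc_prod {E : Type*} [NormedAddCommGroup E]
    {f : ℝ × ℝ → E} (hf : Continuous f) {a b c d : ℝ} :
    IntegrableOn f (Set.uIoc a b ×ˢ Set.uIoc c d) :=
  (hf.integrableOn_Icc (a := (min a b, min c d)) (b := (max a b, max c d))).mono_set
    (Set.Icc_prod_eq (min a b, min c d) (max a b, max c d) ▸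
      Set.prod_mono Set.Ioc_subset_Icc_self Set.Ioc_subset_Icc_self)

/-- The trace of `ψ` on a side of a square, in terms of the gradient and the mean over the
square. -/
theorem trace_square (h : IsC1 ψ ψs ψd) (a : ℝ) {l : ℝ} (hl : 0 < l) :
    ∫ s in a..(a + l), ‖ψ (s, 0)‖ ^ 2 ≤
      3 * l * (∫ s in a..(a + l), ∫ d in 0..l, (‖ψs (s, d)‖ ^ 2 + ‖ψd (s, d)‖ ^ 2)) +
      3 / l ^ 3 * ‖∫ s in a..(a + l), ∫ d in 0..l, ψ (s, d)‖ ^ 2 := by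
  have c := h.cont
  have cs := h.cont_s
  have cd := h.cont_d
  set M := ∫ s in a..(a + l), ∫ d in 0..l, ψ (s, d) with hM
  set Is := ∫ d in 0..l, ∫ s in a..(a + l), ‖ψs (s, d)‖ ^ 2 with hIs
  have hswap : Is = ∫ s in a..(a + l), ∫ d in 0..l, ‖ψs (s, d)‖ ^ 2 := by
    refine intervalIntegral_intervalIntegral_swap ?_
    refine Continuous.integrableOn_uIoc_prod ?_
    exact (by fun_prop : Continuous fun p : ℝ × ℝ => ‖ψs (p.2, p.1)‖ ^ 2)
  have hswapM : M = ∫ d in 0..l, ∫ s in a..(a + l), ψ (s, d) := by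
    refine intervalIntegral_intervalIntegral_swap ?_
    refine Continuous.integrableOn_uIoc_prod ?_
    exact (by fun_prop : Continuous fun p : ℝ × ℝ => ψ (p.1, p.2))
  -- the mean over the transversal segment, compared with the value on the side
  have h1 : ∀ s, ‖l * ψ (s, 0) - ∫ d in 0..l, ψ (s, d)‖ ^ 2 ≤
      l ^ 3 * ∫ d in 0..l, ‖ψd (s, d)‖ ^ 2 := by
    intro s
    have := norm_sub_average_sq_le (h.deriv_d s) (by fun_prop) (a := 0) (x := 0) hl
      ⟨le_rfl, by linarith⟩
    simpa using this
  -- the mean over the transversal segment, compared with the mean over the square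
  have h2 : ∀ s ∈ Set.Icc a (a + l), ‖l * (∫ d in 0..l, ψ (s, d)) - M‖ ^ 2 ≤ l ^ 4 * Is := by
    intro s hs
    have e : l * (∫ d in 0..l, ψ (s, d)) - M =
        ∫ d in 0..l, (l * ψ (s, d) - ∫ r in a..(a + l), ψ (r, d)) := by
      rw [hswapM, intervalIntegral.integral_sub, intervalIntegral.integral_const_mul]
      · exact Continuous.intervalIntegrable (by fun_prop) _ _
      · exact Continuous.intervalIntegrable (by fun_prop) _ _
    rw [e]
    refine (norm_sq_intervalIntegral_le (by fun_prop) hl).trans ?_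
    have : ∫ d in 0..l, ‖l * ψ (s, d) - ∫ r in a..(a + l), ψ (r, d)‖ ^ 2 ≤
        ∫ d in 0..l, l ^ 3 * ∫ r in a..(a + l), ‖ψs (r, d)‖ ^ 2 := by
      refine intervalIntegral.integral_mono_on hl.le
        (Continuous.intervalIntegrable (by fun_prop) _ _)
        (Continuous.intervalIntegrable (by fun_prop) _ _) fun d _ => ?_
      exact norm_sub_average_sq_le (fun s => h.deriv_s s d) (by fun_prop) hl hs
    rw [intervalIntegral.integral_const_mul, ← hIs] at this
    calc _ ≤ (l - 0) * (l ^ 3 * Is) := by rw [sub_zero]; gcongr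
      _ = _ := by ring
  have h3 : ∀ s ∈ Set.Icc a (a + l), ‖ψ (s, 0)‖ ^ 2 ≤
      3 * (l * ∫ d in 0..l, ‖ψd (s, d)‖ ^ 2) + 3 * Is + 3 / l ^ 4 * ‖M‖ ^ 2 := by
    intro s hs
    set X := l * ψ (s, 0) - ∫ d in 0..l, ψ (s, d) with hX
    set Y := l * (∫ d in 0..l, ψ (s, d)) - M with hY
    have e : (l : ℂ) ^ 2 * ψ (s, 0) = l * X + Y + M := by rw [hX, hY]; ring
    have h4 : l ^ 2 * ‖ψ (s, 0)‖ ≤ l * ‖X‖ + ‖Y‖ + ‖M‖ := by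
      have := congrArg norm e
      rw [norm_mul, norm_pow, Complex.norm_real, Real.norm_of_nonneg hl.le] at this
      rw [this]
      refine (norm_add₃_le).trans ?_
      rw [norm_mul, Complex.norm_real, Real.norm_of_nonneg hl.le]
    have h5 := h1 s
    have h6 := h2 s hs
    have h7 : (l ^ 2 * ‖ψ (s, 0)‖) ^ 2 ≤ (l * ‖X‖ + ‖Y‖ + ‖M‖) ^ 2 := by gcongr
    have h8 : (l * ‖X‖ + ‖Y‖ + ‖M‖) ^ 2 ≤ 3 * (l ^ 2 * ‖X‖ ^ 2 + ‖Y‖ ^ 2 + ‖M‖ ^ 2) := by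
      nlinarith [sq_nonneg (l * ‖X‖ - ‖Y‖), sq_nonneg (l * ‖X‖ - ‖M‖), sq_nonneg (‖Y‖ - ‖M‖)]
    have h9 : l ^ 2 * ‖X‖ ^ 2 ≤ l ^ 2 * (l ^ 3 * ∫ d in 0..l, ‖ψd (s, d)‖ ^ 2) := by gcongr
    have h10 : l ^ 4 * ‖ψ (s, 0)‖ ^ 2 ≤ l ^ 4 * (3 * (l * ∫ d in 0..l, ‖ψd (s, d)‖ ^ 2) +
        3 * Is + 3 / l ^ 4 * ‖M‖ ^ 2) := by
      have : l ^ 4 * (3 / l ^ 4 * ‖M‖ ^ 2) = 3 * ‖M‖ ^ 2 := by field_simp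
      nlinarith
    exact le_of_mul_le_mul_left h10 (by positivity)
  have h4 : ∫ s in a..(a + l), ‖ψ (s, 0)‖ ^ 2 ≤ ∫ s in a..(a + l),
      (3 * (l * ∫ d in 0..l, ‖ψd (s, d)‖ ^ 2) + 3 * Is + 3 / l ^ 4 * ‖M‖ ^ 2) := by
    refine intervalIntegral.integral_mono_on (by linarith)
      (Continuous.intervalIntegrable (by fun_prop) _ _)
      (Continuous.intervalIntegrable (by fun_prop) _ _) h3
  refine h4.trans (le_of_eq ?_)
  have e1 : ∀ s, ∫ d in 0..l, (‖ψs (s, d)‖ ^ 2 + ‖ψd (s, d)‖ ^ 2) =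
      (∫ d in 0..l, ‖ψs (s, d)‖ ^ 2) + ∫ d in 0..l, ‖ψd (s, d)‖ ^ 2 := fun s =>
    intervalIntegral.integral_add (Continuous.intervalIntegrable (by fun_prop) _ _)
      (Continuous.intervalIntegrable (by fun_prop) _ _)
  simp only [e1]
  rw [intervalIntegral.integral_add, intervalIntegral.integral_add,
    intervalIntegral.integral_add, intervalIntegral.integral_const_mul,
    intervalIntegral.integral_const_mul, intervalIntegral.integral_const,
    intervalIntegral.integral_const, ← hswap, smul_eq_mul, smul_eq_mul]
  · field_simp
    ring
  all_goals exact Continuous.intervalIntegrable (by fun_prop) _ _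

/-- The exponentially weighted trace on the ray is controlled, up to small multiples of the trace
and of the kinetic energy, by the means over finitely many squares. -/
theorem exp_trace_le (h : IsC1 ψ ψs ψd) {T c l ε : ℝ} {M : ℕ} (hT : 0 ≤ T) (hc : 0 ≤ c)
    (hl : 0 < l) (hε : Real.exp (-(c * (M * l))) ≤ ε) :
    ∫ s in Set.Ioi 0, Real.exp (-(c * s)) * ‖ψ (s, 0)‖ ^ 2 ≤
      ε * (∫ s in Set.Ioi 0, ‖ψ (s, 0)‖ ^ 2) +
      3 * l * (∫ p in wedge T (Set.Ioi 0), (‖ψs p‖ ^ 2 + ‖ψd p‖ ^ 2)) +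
      3 / l ^ 3 * ∑ i ∈ Finset.range M,
        ‖∫ p in Set.Ioc (i * l) (i * l + l) ×ˢ Set.Ioc 0 l, ψ p‖ ^ 2 := by
  have c0 := h.cont
  have cs := h.cont_s
  have cd := h.cont_d
  have hε0 : 0 ≤ ε := (Real.exp_pos _).le.trans hε
  have hMl : 0 ≤ M * l := by positivity
  have it := h.integrable_trace
  have ie := h.integrable_exp_trace c
  have hfar : ∫ s in Set.Ioi (M * l), Real.exp (-(c * s)) * ‖ψ (s, 0)‖ ^ 2 ≤
      ε * ∫ s in Set.Ioi 0, ‖ψ (s, 0)‖ ^ 2 := by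
    rw [← integral_const_mul]
    calc _ ≤ ∫ s in Set.Ioi (M * l), ε * ‖ψ (s, 0)‖ ^ 2 := by
          refine setIntegral_mono_on ie.integrableOn (it.const_mul ε).integrableOn
            measurableSet_Ioi fun s hs => ?_
          have hs' : M * l < s := hs
          gcongr
          refine le_trans (Real.exp_le_exp.2 ?_) hε
          nlinarith
      _ ≤ _ := setIntegral_mono_set (it.const_mul ε).integrableOn
          (ae_of_all _ fun s => by positivity) (Set.Ioi_subset_Ioi hMl).eventuallyLE
  have hnear : ∫ s in Set.Ioc 0 (M * l), Real.exp (-(c * s)) * ‖ψ (s, 0)‖ ^ 2 ≤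
      ∫ s in 0..(M * l), ‖ψ (s, 0)‖ ^ 2 := by
    rw [intervalIntegral.integral_of_le hMl]
    refine setIntegral_mono_on ie.integrableOn it.integrableOn measurableSet_Ioc fun s hs => ?_
    have : Real.exp (-(c * s)) ≤ 1 := Real.exp_le_one_iff.2 (by nlinarith [hs.1])
    nlinarith [sq_nonneg ‖ψ (s, 0)‖]
  have hsum : ∀ f : ℝ → ℝ, Continuous f → ∑ i ∈ Finset.range M, ∫ s in (i * l)..(i * l + l), f s =
      ∫ s in 0..(M * l), f s := by
    intro f hf
    have := intervalIntegral.sum_integral_adjacent_intervals (μ := volume) (f := f)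
      (a := fun i : ℕ => (i : ℝ) * l) (n := M) fun k _ => hf.intervalIntegrable _ _
    simpa [add_mul] using this
  have hG : Integrable fun p => ‖ψs p‖ ^ 2 + ‖ψd p‖ ^ 2 :=
    (integrable_norm_sq h.compact_s cs).add (integrable_norm_sq h.compact_d cd)
  have hbox : ∫ s in 0..(M * l), ∫ d in 0..l, (‖ψs (s, d)‖ ^ 2 + ‖ψd (s, d)‖ ^ 2) ≤
      ∫ p in wedge T (Set.Ioi 0), (‖ψs p‖ ^ 2 + ‖ψd p‖ ^ 2) := by
    rw [intervalIntegral.integral_of_le hMl]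
    simp only [intervalIntegral.integral_of_le hl.le]
    rw [← setIntegral_prod (fun p => ‖ψs p‖ ^ 2 + ‖ψd p‖ ^ 2)
      (by rw [← Measure.volume_eq_prod]; exact hG.integrableOn), ← Measure.volume_eq_prod]
    refine setIntegral_mono_set hG.integrableOn (ae_of_all _ fun p => by positivity)
      (LE.le.eventuallyLE ?_)
    rintro p ⟨hp1, hp2⟩
    exact ⟨hp1.1, lt_of_le_of_lt (by nlinarith [mul_nonneg hT hp1.1.le]) hp2.1⟩
  have hsq : ∀ i : ℕ, ∫ p in Set.Ioc (i * l) (i * l + l) ×ˢ Set.Ioc 0 l, ψ p =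
      ∫ s in (i * l)..(i * l + l), ∫ d in 0..l, ψ (s, d) := by
    intro i
    rw [intervalIntegral.integral_of_le (by linarith)]
    simp only [intervalIntegral.integral_of_le hl.le]
    rw [← setIntegral_prod ψ, ← Measure.volume_eq_prod]
    exact (c0.integrable_of_hasCompactSupport h.compact).integrableOn
  have hmain : ∫ s in 0..(M * l), ‖ψ (s, 0)‖ ^ 2 ≤
      3 * l * (∫ p in wedge T (Set.Ioi 0), (‖ψs p‖ ^ 2 + ‖ψd p‖ ^ 2)) +
      3 / l ^ 3 * ∑ i ∈ Finset.range M,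
        ‖∫ p in Set.Ioc (i * l) (i * l + l) ×ˢ Set.Ioc 0 l, ψ p‖ ^ 2 := by
    calc _ = ∑ i ∈ Finset.range M, ∫ s in (i * l)..(i * l + l), ‖ψ (s, 0)‖ ^ 2 :=
          (hsum _ (by fun_prop)).symm
      _ ≤ ∑ i ∈ Finset.range M,
          (3 * l * (∫ s in (i * l)..(i * l + l), ∫ d in 0..l,
            (‖ψs (s, d)‖ ^ 2 + ‖ψd (s, d)‖ ^ 2)) +
          3 / l ^ 3 * ‖∫ p in Set.Ioc (i * l) (i * l + l) ×ˢ Set.Ioc 0 l, ψ p‖ ^ 2) := by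
          refine Finset.sum_le_sum fun i _ => ?_
          rw [hsq]
          exact h.trace_square _ hl
      _ = 3 * l * (∫ s in 0..(M * l), ∫ d in 0..l, (‖ψs (s, d)‖ ^ 2 + ‖ψd (s, d)‖ ^ 2)) +
          3 / l ^ 3 * ∑ i ∈ Finset.range M,
            ‖∫ p in Set.Ioc (i * l) (i * l + l) ×ˢ Set.Ioc 0 l, ψ p‖ ^ 2 := by
          rw [Finset.sum_add_distrib, ← Finset.mul_sum, ← Finset.mul_sum,
            hsum (fun s => ∫ d in 0..l, (‖ψs (s, d)‖ ^ 2 + ‖ψd (s, d)‖ ^ 2)) (by fun_prop)]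
      _ ≤ _ := by gcongr
  rw [← Set.Ioc_union_Ioi_eq_Ioi hMl, setIntegral_union (Set.Ioc_disjoint_Ioi le_rfl)
    measurableSet_Ioi ie.integrableOn ie.integrableOn, Set.Ioc_union_Ioi_eq_Ioi hMl]
  linarith

end IsC1

end

/-! ### Coordinates along and across the two rays -/

section

/-- The point of the plane with coordinate `p.1` along the ray in direction `(cos θ, σ sin θ)` and
coordinate `p.2` perpendicular to it, where the sign `σ = ±1` selects the ray. -/
def frame (θ σ : ℝ) (p : ℝ × ℝ) : Plane :=
  !₂[p.1 * Real.cos θ - p.2 * Real.sin θ, σ * (p.1 * Real.sin θ + p.2 * Real.cos θ)]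

theorem frame_eq_add_smul (θ σ s d : ℝ) : frame θ σ (s, d) =
    s • !₂[Real.cos θ, σ * Real.sin θ] + d • !₂[-Real.sin θ, σ * Real.cos θ] := by
  ext j
  fin_cases j <;> simp [frame] <;> ring

theorem norm_frame_sq (θ : ℝ) {σ : ℝ} (hσ : σ * σ = 1) (p : ℝ × ℝ) :
    ‖frame θ σ p‖ ^ 2 = p.1 ^ 2 + p.2 ^ 2 := by
  rw [EuclideanSpace.norm_sq_eq, Fin.sum_univ_two]
  simp only [frame, Real.norm_eq_abs, sq_abs, PiLp.toLp_apply, Matrix.cons_val_zero,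
    Matrix.cons_val_one]
  linear_combination (p.1 ^ 2 + p.2 ^ 2) * Real.sin_sq_add_cos_sq θ +
    (p.1 * Real.sin θ + p.2 * Real.cos θ) ^ 2 * hσ

theorem continuous_frame (θ σ : ℝ) : Continuous (frame θ σ) := by
  have : frame θ σ = fun p => p.1 • !₂[Real.cos θ, σ * Real.sin θ] +
      p.2 • !₂[-Real.sin θ, σ * Real.cos θ] := funext fun p => frame_eq_add_smul θ σ p.1 p.2
  rw [this]
  fun_prop

/-- The change of coordinates `frame` as a linear isometry of the Euclidean plane. -/
def frameIso (θ : ℝ) {σ : ℝ} (hσ : σ * σ = 1) : Plane ≃ₗᵢ[ℝ] Plane :=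
  LinearIsometry.toLinearIsometryEquiv
    { toFun := fun x => frame θ σ (x 0, x 1)
      map_add' := fun x y => by ext j; fin_cases j <;> simp [frame] <;> ring
      map_smul' := fun c x => by ext j; fin_cases j <;> simp [frame] <;> ring
      norm_map' := fun x => by
        have h := norm_frame_sq θ hσ (x 0, x 1)
        have h' := EuclideanSpace.norm_sq_eq x
        simp only [Fin.sum_univ_two, Real.norm_eq_abs, sq_abs] at h'
        rw [← h'] at h
        exact (sq_eq_sq₀ (norm_nonneg _) (norm_nonneg _)).1 h } rfl

/-- Cartesian coordinates, as a measurable equivalence. -/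
def planeEquiv : ℝ × ℝ ≃ᵐ Plane :=
  MeasurableEquiv.finTwoArrow.symm.trans (MeasurableEquiv.toLp 2 (Fin 2 → ℝ))

theorem measurePreserving_planeEquiv : MeasurePreserving planeEquiv :=
  (PiLp.volume_preserving_toLp (Fin 2)).comp (volume_preserving_finTwoArrow ℝ).symm

theorem frame_eq_comp (θ : ℝ) {σ : ℝ} (hσ : σ * σ = 1) :
    frame θ σ = frameIso θ hσ ∘ planeEquiv := by
  funext p
  rfl

theorem measurePreserving_frame (θ : ℝ) {σ : ℝ} (hσ : σ * σ = 1) :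
    MeasurePreserving (frame θ σ) := by
  rw [frame_eq_comp θ hσ]
  exact (frameIso θ hσ).measurePreserving.comp measurePreserving_planeEquiv

theorem measurableEmbedding_frame (θ : ℝ) {σ : ℝ} (hσ : σ * σ = 1) :
    MeasurableEmbedding (frame θ σ) := by
  rw [frame_eq_comp θ hσ]
  exact (frameIso θ hσ).toHomeomorph.measurableEmbedding.comp planeEquiv.measurableEmbedding

/-- The open half-plane above (`σ = 1`) or below (`σ = -1`) the axis of symmetry. -/
def halfPlane (σ : ℝ) : Set Plane := {x | 0 < σ * x 1}

theorem measurableSet_halfPlane (σ : ℝ) : MeasurableSet (halfPlane σ) :=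
  (isOpen_lt continuous_const (by fun_prop)).measurableSet

theorem cos_pos_of_mem {θ : ℝ} (hθ : θ ∈ Set.Ioo 0 (Real.pi / 2)) : 0 < Real.cos θ :=
  Real.cos_pos_of_mem_Ioo ⟨by linarith [hθ.1, Real.pi_pos], hθ.2⟩

theorem sin_pos_of_mem {θ : ℝ} (hθ : θ ∈ Set.Ioo 0 (Real.pi / 2)) : 0 < Real.sin θ :=
  Real.sin_pos_of_pos_of_lt_pi hθ.1 (by linarith [hθ.2, Real.pi_pos])

theorem tan_pos_of_mem {θ : ℝ} (hθ : θ ∈ Set.Ioo 0 (Real.pi / 2)) : 0 < Real.tan θ :=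
  Real.tan_pos_of_pos_of_lt_pi_div_two hθ.1 hθ.2

theorem frame_preimage_halfPlane {θ σ : ℝ} (hθ : θ ∈ Set.Ioo 0 (Real.pi / 2)) (hσ : σ * σ = 1) :
    frame θ σ ⁻¹' halfPlane σ = wedge (Real.tan θ) Set.univ := by
  have hc := cos_pos_of_mem hθ
  ext p
  simp only [frame, halfPlane, wedge, Set.mem_preimage, Set.mem_ofPred_eq, Set.mem_univ, true_and,
    Matrix.cons_val_one, Matrix.cons_val_fin_one]
  rw [← mul_assoc, hσ, one_mul, Real.tan_eq_sin_div_cos]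
  have e : (Real.sin θ / Real.cos θ * p.1 + p.2) * Real.cos θ =
      p.1 * Real.sin θ + p.2 * Real.cos θ := by
    field_simp
  rw [neg_lt_iff_pos_add', ← e, mul_pos_iff_of_pos_right hc]

theorem setIntegral_halfPlane {θ σ : ℝ} (hθ : θ ∈ Set.Ioo 0 (Real.pi / 2)) (hσ : σ * σ = 1)
    (g : Plane → ℝ) :
    ∫ x in halfPlane σ, g x = ∫ p in wedge (Real.tan θ) Set.univ, g (frame θ σ p) := by
  rw [← frame_preimage_halfPlane hθ hσ]
  exact ((measurePreserving_frame θ hσ).setIntegral_preimage_emb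
    (measurableEmbedding_frame θ hσ) g _).symm

theorem ae_second_coord_ne_zero : ∀ᵐ x : Plane, x 1 ≠ 0 := by
  have h : ∀ᵐ p : ℝ × ℝ, p.2 ≠ 0 := by
    have h0 : ∀ᵐ d : ℝ, d ≠ 0 := by simp [ae_iff]
    exact Measure.quasiMeasurePreserving_snd.ae h0
  have := (measurePreserving_planeEquiv.symm).quasiMeasurePreserving.ae h
  filter_upwards [this] with x hx
  exact hx

theorem integral_eq_add_halfPlane {g : Plane → ℝ} (hg : Integrable g) :
    ∫ x, g x = (∫ x in halfPlane 1, g x) + ∫ x in halfPlane (-1), g x := by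
  rw [← setIntegral_union ?_ (measurableSet_halfPlane _) hg.integrableOn hg.integrableOn,
    ← setIntegral_univ]
  · refine setIntegral_congr_set ?_
    filter_upwards [ae_second_coord_ne_zero] with x hx
    refine propext ⟨fun _ => ?_, fun _ => trivial⟩
    rcases lt_or_gt_of_ne hx with h | h
    · right; change 0 < -1 * x 1; linarith
    · left; change 0 < 1 * x 1; linarith
  · refine Set.disjoint_left.2 fun x h1 h2 => ?_
    have h1' : 0 < 1 * x 1 := h1
    have h2' : 0 < -1 * x 1 := h2
    linarith

theorem integrable_comp_frame (θ : ℝ) {σ : ℝ} (hσ : σ * σ = 1) {g : Plane → ℝ}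
    (hg : Integrable g) : Integrable fun p => g (frame θ σ p) :=
  (measurePreserving_frame θ hσ).integrable_comp_emb (measurableEmbedding_frame θ hσ) |>.2 hg

/-- The wedges between the rays and the lines perpendicular to them and to the axis do not
overlap. -/
theorem wedge_add_wedge_le {θ : ℝ} (hθ : θ ∈ Set.Ioo 0 (Real.pi / 2)) {g : Plane → ℝ}
    (hg : Integrable g) (h0 : ∀ x, 0 ≤ g x) :
    (∫ p in wedge (Real.tan θ) (Set.Ioi 0), g (frame θ 1 p)) +
      (∫ p in wedge (Real.tan θ) (Set.Ioi 0), g (frame θ (-1) p)) ≤ ∫ x, g x := by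
  have key : ∀ σ : ℝ, σ * σ = 1 → ∫ p in wedge (Real.tan θ) (Set.Ioi 0), g (frame θ σ p) ≤
      ∫ x in halfPlane σ, g x := by
    intro σ hσ
    rw [setIntegral_halfPlane hθ hσ]
    refine setIntegral_mono_set (integrable_comp_frame θ hσ hg).integrableOn
      (ae_of_all _ fun _ => h0 _) (LE.le.eventuallyLE ?_)
    exact fun p hp => ⟨trivial, hp.2⟩
  rw [integral_eq_add_halfPlane hg]
  exact add_le_add (key 1 (by norm_num)) (key (-1) (by norm_num))

theorem isometry_frame_ray (θ : ℝ) {σ : ℝ} (hσ : σ * σ = 1) :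
    Isometry fun s : ℝ => frame θ σ (s, 0) := by
  refine Isometry.of_dist_eq fun a b => ?_
  have h : frame θ σ (a, 0) - frame θ σ (b, 0) = frame θ σ (a - b, 0) := by
    simp only [frame_eq_add_smul]; module
  have h2 := norm_frame_sq θ hσ (a - b, 0)
  rw [dist_eq_norm, h, Real.dist_eq, ← abs_of_nonneg (norm_nonneg (frame θ σ (a - b, 0))),
    ← sq_eq_sq_iff_abs_eq_abs, h2]
  ring

theorem ray_eq_image {θ : ℝ} (hθ : θ ∈ Set.Ioo 0 (Real.pi / 2)) (σ : ℝ) :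
    ray θ σ = (fun s : ℝ => frame θ σ (s, 0)) '' Set.Ioi 0 := by
  have hc := cos_pos_of_mem hθ
  ext x
  simp only [ray, Set.mem_ofPred_eq, Set.mem_image, Set.mem_Ioi]
  constructor
  · rintro ⟨t, ht, rfl⟩
    refine ⟨t / Real.cos θ, by positivity, ?_⟩
    ext j
    fin_cases j
    · simp [frame]; field_simp
    · simp [frame, Real.tan_eq_sin_div_cos]; left; field_simp
  · rintro ⟨s, hs, rfl⟩
    refine ⟨s * Real.cos θ, by positivity, ?_⟩
    ext j
    fin_cases j
    · simp [frame]
    · simp [frame, Real.tan_eq_sin_div_cos]; left; field_simp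

theorem brokenLine_eq {θ : ℝ} (hθ : θ ∈ Set.Ioo 0 (Real.pi / 2)) :
    brokenLine θ = ray θ 1 ∪ ray θ (-1) ∪ {0} := by
  have hcl : ∀ σ : ℝ, σ * σ = 1 → closure (ray θ σ) = ray θ σ ∪ {0} := by
    intro σ hσ
    rw [ray_eq_image hθ, (isometry_frame_ray θ hσ).isClosedEmbedding.closure_image_eq,
      closure_Ioi]
    have h0 : frame θ σ (0, 0) = 0 := by simp [frame_eq_add_smul]
    rw [← Set.Ioi_union_left, Set.image_union, Set.image_singleton, h0]
  rw [brokenLine, closure_union, hcl 1 (by norm_num), hcl (-1) (by norm_num)]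
  rw [Set.union_union_union_comm, Set.union_self]

theorem measurableSet_ray {θ : ℝ} (hθ : θ ∈ Set.Ioo 0 (Real.pi / 2)) {σ : ℝ} (hσ : σ * σ = 1) :
    MeasurableSet (ray θ σ) := by
  rw [ray_eq_image hθ]
  exact (isometry_frame_ray θ hσ).isClosedEmbedding.measurableEmbedding.measurableSet_image.2
    measurableSet_Ioi

theorem hausdorffMeasure_restrict_ray {θ : ℝ} (hθ : θ ∈ Set.Ioo 0 (Real.pi / 2)) {σ : ℝ}
    (hσ : σ * σ = 1) : (Measure.hausdorffMeasure 1 : Measure Plane).restrict (ray θ σ) =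
      Measure.map (fun s : ℝ => frame θ σ (s, 0)) (volume.restrict (Set.Ioi 0)) := by
  have hi := isometry_frame_ray θ hσ
  have he := hi.isClosedEmbedding.measurableEmbedding
  have h1 := hi.map_hausdorffMeasure (d := 1) (Or.inl zero_le_one)
  rw [hausdorffMeasure_real] at h1
  have h2 : Set.Ioi (0 : ℝ) = (fun s : ℝ => frame θ σ (s, 0)) ⁻¹' ray θ σ := by
    rw [ray_eq_image hθ, Set.preimage_image_eq _ hi.injective]
  rw [h2, ← he.restrict_map, h1, Measure.restrict_restrict (measurableSet_ray hθ hσ),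
    Set.inter_eq_left.2]
  rw [ray_eq_image hθ]
  exact Set.image_subset_range _ _

/-- The arc length measure on `Γ` is Lebesgue measure transported to the two rays. -/
theorem arcLength_eq {θ : ℝ} (hθ : θ ∈ Set.Ioo 0 (Real.pi / 2)) : arcLength θ =
    Measure.map (fun s : ℝ => frame θ 1 (s, 0)) (volume.restrict (Set.Ioi 0)) +
      Measure.map (fun s : ℝ => frame θ (-1) (s, 0)) (volume.restrict (Set.Ioi 0)) := by
  have hT := tan_pos_of_mem hθ
  have hdisj : Disjoint (ray θ 1) (ray θ (-1)) := by
    refine Set.disjoint_left.2 ?_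
    rintro x ⟨t, ht, rfl⟩ ⟨t', ht', h⟩
    have h1 := congrArg (fun y : Plane => y 1) h
    simp only [Matrix.cons_val_one, Matrix.cons_val_fin_one] at h1
    nlinarith [mul_pos ht hT, mul_pos ht' hT]
  rw [← hausdorffMeasure_restrict_ray hθ (by norm_num),
    ← hausdorffMeasure_restrict_ray hθ (by norm_num),
    ← Measure.restrict_union hdisj (measurableSet_ray hθ (by norm_num)), arcLength,
    brokenLine_eq hθ]
  refine Measure.restrict_congr_set ?_
  rw [Set.union_singleton]
  have := Measure.nullSingletonClass_hausdorff Plane (d := 1) zero_lt_one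
  exact insert_ae_eq_self _ _

theorem integral_arcLength {θ : ℝ} (hθ : θ ∈ Set.Ioo 0 (Real.pi / 2)) {g : Plane → ℝ}
    (hg : ∀ σ : ℝ, σ * σ = 1 → IntegrableOn (fun s => g (frame θ σ (s, 0))) (Set.Ioi 0)) :
    ∫ x, g x ∂(arcLength θ) = (∫ s in Set.Ioi 0, g (frame θ 1 (s, 0))) +
      ∫ s in Set.Ioi 0, g (frame θ (-1) (s, 0)) := by
  have h1 : (1 : ℝ) * 1 = 1 := by norm_num
  have h2 : (-1 : ℝ) * -1 = 1 := by norm_num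
  have e1 := (isometry_frame_ray θ h1).isClosedEmbedding.measurableEmbedding
  have e2 := (isometry_frame_ray θ h2).isClosedEmbedding.measurableEmbedding
  rw [arcLength_eq hθ, integral_add_measure, e1.integral_map, e2.integral_map]
  · exact e1.integrable_map_iff.2 (hg 1 h1)
  · exact e2.integrable_map_iff.2 (hg (-1) h2)

theorem isFiniteMeasureOnCompacts_arcLength {θ : ℝ} (hθ : θ ∈ Set.Ioo 0 (Real.pi / 2)) :
    IsFiniteMeasureOnCompacts (arcLength θ) := by
  refine ⟨fun K hK => ?_⟩
  have key : ∀ σ : ℝ, σ * σ = 1 → Measure.map (fun s : ℝ => frame θ σ (s, 0))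
      (volume.restrict (Set.Ioi 0)) K < ⊤ := by
    intro σ hσ
    have e := (isometry_frame_ray θ hσ).isClosedEmbedding
    rw [e.measurableEmbedding.map_apply]
    exact (Measure.restrict_apply_le _ _).trans_lt (e.isCompact_preimage hK).measure_lt_top
  rw [arcLength_eq hθ, Measure.add_apply]
  exact ENNReal.add_lt_top.2 ⟨key 1 (by norm_num), key (-1) (by norm_num)⟩

theorem hasDerivAt_frame_left (θ σ s d : ℝ) : HasDerivAt (fun s => frame θ σ (s, d))
    !₂[Real.cos θ, σ * Real.sin θ] s := by
  simp only [frame_eq_add_smul]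
  simpa using ((hasDerivAt_id s).smul_const !₂[Real.cos θ, σ * Real.sin θ]).add_const
    (d • !₂[-Real.sin θ, σ * Real.cos θ])

theorem hasDerivAt_frame_right (θ σ s d : ℝ) : HasDerivAt (fun d => frame θ σ (s, d))
    !₂[-Real.sin θ, σ * Real.cos θ] d := by
  simp only [frame_eq_add_smul]
  simpa using ((hasDerivAt_id d).smul_const !₂[-Real.sin θ, σ * Real.cos θ]).const_add
    (s • !₂[Real.cos θ, σ * Real.sin θ])

theorem fderiv_apply_pair (φ : Plane → ℂ) (x : Plane) (a b : ℝ) :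
    fderiv ℝ φ x !₂[a, b] = a * pderiv 0 φ x + b * pderiv 1 φ x := by
  have : !₂[a, b] = a • EuclideanSpace.single (0 : Fin 2) (1 : ℝ) +
      b • EuclideanSpace.single (1 : Fin 2) (1 : ℝ) := by
    ext j; fin_cases j <;> simp
  rw [this, map_add, map_smul, map_smul]
  simp [pderiv]

theorem IsTest.isC1_comp_frame {φ : Plane → ℂ} (h : IsTest φ) (θ : ℝ) {σ : ℝ} (hσ : σ * σ = 1) :
    IsC1 (fun p => φ (frame θ σ p))
      (fun p => Real.cos θ * pderiv 0 φ (frame θ σ p) +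
        (σ * Real.sin θ : ℝ) * pderiv 1 φ (frame θ σ p))
      (fun p => (-Real.sin θ : ℝ) * pderiv 0 φ (frame θ σ p) +
        (σ * Real.cos θ : ℝ) * pderiv 1 φ (frame θ σ p)) := by
  have hf := continuous_frame θ σ
  have h0 := h.continuous_pderiv 0
  have h1 := h.continuous_pderiv 1
  have hp : frame θ σ = frameIso θ hσ ∘ (WithLp.toLp 2 ∘ Homeomorph.finTwoArrow.symm) := by
    funext p; rfl
  refine ⟨?_, h.smooth.continuous.comp hf, by fun_prop, by fun_prop, fun s d => ?_, fun s d => ?_⟩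
  · have he : IsClosedEmbedding (frame θ σ) := by
      rw [hp]
      exact (frameIso θ hσ).toHomeomorph.isClosedEmbedding.comp
        ((PiLp.homeomorph 2 (fun _ : Fin 2 => ℝ)).symm.isClosedEmbedding.comp
          Homeomorph.finTwoArrow.symm.isClosedEmbedding)
    exact h.compact.comp_isClosedEmbedding he
  · have := (h.differentiable (frame θ σ (s, d))).hasFDerivAt.comp_hasDerivAt s
      (hasDerivAt_frame_left θ σ s d)
    rwa [fderiv_apply_pair] at this
  · have := (h.differentiable (frame θ σ (s, d))).hasFDerivAt.comp_hasDerivAt d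
      (hasDerivAt_frame_right θ σ s d)
    rwa [fderiv_apply_pair] at this

theorem norm_sq_rotate (θ : ℝ) {σ : ℝ} (hσ : σ * σ = 1) (a b : ℂ) :
    ‖Real.cos θ * a + (σ * Real.sin θ : ℝ) * b‖ ^ 2 +
      ‖(-Real.sin θ : ℝ) * a + (σ * Real.cos θ : ℝ) * b‖ ^ 2 = ‖a‖ ^ 2 + ‖b‖ ^ 2 := by
  simp only [← Complex.normSq_eq_norm_sq, Complex.normSq_apply, Complex.add_re, Complex.add_im,
    Complex.mul_re, Complex.mul_im, Complex.ofReal_re, Complex.ofReal_im]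
  linear_combination (a.re ^ 2 + a.im ^ 2 + b.re ^ 2 + b.im ^ 2) * Real.sin_sq_add_cos_sq θ +
    (b.re ^ 2 + b.im ^ 2) * (Real.sin θ ^ 2 + Real.cos θ ^ 2) * hσ

end

/-! ### The form on test functions -/

section

/-- The complex vector space of test functions. -/
def testSpace : Submodule ℂ (Plane → ℂ) where
  carrier := {φ | IsTest φ}
  zero_mem' := IsTest.zero
  add_mem' h h' := h.add h'
  smul_mem' c _ h := h.const_mul c

theorem IsTest.memLp_arcLength {φ : Plane → ℂ} (h : IsTest φ) {θ : ℝ}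
    (hθ : θ ∈ Set.Ioo 0 (Real.pi / 2)) : MemLp φ 2 (arcLength θ) := by
  have := isFiniteMeasureOnCompacts_arcLength hθ
  exact h.smooth.continuous.memLp_of_hasCompactSupport h.compact

/-- The inclusion of the test functions in `L²(ℝ²)`. -/
def toL2 : testSpace →ₗ[ℂ] L2Plane where
  toFun φ := (IsTest.memLp φ.2).toLp φ
  map_add' φ ψ := MemLp.toLp_add (IsTest.memLp φ.2) (IsTest.memLp ψ.2)
  map_smul' c φ := MemLp.toLp_const_smul c (IsTest.memLp φ.2)

/-- The partial derivatives of test functions, as elements of `L²(ℝ²)`. -/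
def gradL2 (j : Fin 2) : testSpace →ₗ[ℂ] L2Plane where
  toFun φ := (IsTest.memLp_pderiv φ.2 j).toLp (pderiv j φ)
  map_add' φ ψ := by
    rw [← MemLp.toLp_add]
    exact MemLp.toLp_congr _ _ (ae_of_all _ (congrFun (pderiv_add φ.2 ψ.2 j)))
  map_smul' c φ := by
    rw [RingHom.id_apply, ← MemLp.toLp_const_smul]
    exact MemLp.toLp_congr _ _ (ae_of_all _ (congrFun (pderiv_const_mul c φ.2 j)))

/-- The restriction of test functions to the broken line, as elements of `L²(Γ, ds)`. -/
def traceL2 {θ : ℝ} (hθ : θ ∈ Set.Ioo 0 (Real.pi / 2)) : testSpace →ₗ[ℂ] L2Line θ where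
  toFun φ := (IsTest.memLp_arcLength φ.2 hθ).toLp φ
  map_add' φ ψ := MemLp.toLp_add (IsTest.memLp_arcLength φ.2 hθ) (IsTest.memLp_arcLength ψ.2 hθ)
  map_smul' c φ := MemLp.toLp_const_smul c (IsTest.memLp_arcLength φ.2 hθ)

theorem norm_toLp_sq {μ : Measure Plane} {f : Plane → ℂ} (hf : MemLp f 2 μ) :
    ‖hf.toLp f‖ ^ 2 = ∫ x, ‖f x‖ ^ 2 ∂μ := by
  rw [← @inner_self_eq_norm_sq ℂ, L2.inner_def]
  have : ∫ x, inner ℂ (hf.toLp f x) (hf.toLp f x) ∂μ = ∫ x, ((‖f x‖ ^ 2 : ℝ) : ℂ) ∂μ := by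
    refine integral_congr_ae ?_
    filter_upwards [hf.coeFn_toLp] with x hx
    rw [hx, inner_self_eq_norm_sq_to_K]
    simp
  rw [this]
  exact (congrArg Complex.re (integral_ofReal (𝕜 := ℂ))).trans (Complex.ofReal_re _)

theorem integrable_norm_sq_of_memLp {μ : Measure Plane} {f : Plane → ℂ} (hf : MemLp f 2 μ) :
    Integrable (fun x => ‖f x‖ ^ 2) μ := hf.integrable_norm_pow (by norm_num)

theorem norm_toL2_sq (φ : testSpace) : ‖toL2 φ‖ ^ 2 = ∫ x, ‖φ.1 x‖ ^ 2 :=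
  norm_toLp_sq (IsTest.memLp φ.2)

theorem norm_gradL2_sq (j : Fin 2) (φ : testSpace) :
    ‖gradL2 j φ‖ ^ 2 = ∫ x, ‖pderiv j φ x‖ ^ 2 :=
  norm_toLp_sq (IsTest.memLp_pderiv φ.2 j)

/-- The kinetic energy `∬ |∇φ|² dx` of a test function. -/
def kinetic (φ : testSpace) : ℝ := ∑ j : Fin 2, ‖gradL2 j φ‖ ^ 2

theorem kinetic_nonneg (φ : testSpace) : 0 ≤ kinetic φ :=
  Finset.sum_nonneg fun _ _ => sq_nonneg _

theorem kinetic_eq (φ : testSpace) :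
    kinetic φ = ∫ x, (‖pderiv 0 φ x‖ ^ 2 + ‖pderiv 1 φ x‖ ^ 2) := by
  rw [integral_add (integrable_norm_sq_of_memLp (IsTest.memLp_pderiv φ.2 0))
    (integrable_norm_sq_of_memLp (IsTest.memLp_pderiv φ.2 1)), kinetic, Fin.sum_univ_two,
    norm_gradL2_sq, norm_gradL2_sq]

variable {θ : ℝ}

theorem norm_traceL2_sq (hθ : θ ∈ Set.Ioo 0 (Real.pi / 2)) (φ : testSpace) :
    ‖traceL2 hθ φ‖ ^ 2 = (∫ s in Set.Ioi 0, ‖φ.1 (frame θ 1 (s, 0))‖ ^ 2) +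
      ∫ s in Set.Ioi 0, ‖φ.1 (frame θ (-1) (s, 0))‖ ^ 2 := by
  refine (norm_toLp_sq (IsTest.memLp_arcLength φ.2 hθ)).trans
    (integral_arcLength (g := fun x => ‖φ.1 x‖ ^ 2) hθ fun σ hσ => ?_)
  exact (IsTest.isC1_comp_frame φ.2 θ hσ).integrable_trace.integrableOn

/-- Robin estimates on the lines perpendicular to the two rays: up to a remainder that is
exponentially small far from the vertex, the form is at least `-k² ‖φ‖²` when `α = 2 k`. -/
theorem robin_brokenLine (hθ : θ ∈ Set.Ioo 0 (Real.pi / 2)) {k : ℝ} (hk : 0 < k)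
    (φ : testSpace) :
    2 * k * ‖traceL2 hθ φ‖ ^ 2 ≤ kinetic φ + k ^ 2 * ‖toL2 φ‖ ^ 2 +
      k * ((∫ s in Set.Ioi 0, Real.exp (-(k * Real.tan θ * s)) *
          ‖φ.1 (frame θ 1 (s, 0))‖ ^ 2) +
        ∫ s in Set.Ioi 0, Real.exp (-(k * Real.tan θ * s)) *
          ‖φ.1 (frame θ (-1) (s, 0))‖ ^ 2) := by
  have hT := tan_pos_of_mem hθ
  have i0 := integrable_norm_sq_of_memLp (IsTest.memLp_pderiv φ.2 0)
  have i1 := integrable_norm_sq_of_memLp (IsTest.memLp_pderiv φ.2 1)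
  have key : ∀ σ : ℝ, σ * σ = 1 → k * (2 * (∫ s in Set.Ioi 0, ‖φ.1 (frame θ σ (s, 0))‖ ^ 2) -
        ∫ s in Set.Ioi 0, Real.exp (-(k * Real.tan θ * s)) * ‖φ.1 (frame θ σ (s, 0))‖ ^ 2) ≤
      (∫ p in wedge (Real.tan θ) (Set.Ioi 0), (‖pderiv 0 φ (frame θ σ p)‖ ^ 2 +
        ‖pderiv 1 φ (frame θ σ p)‖ ^ 2)) +
      k ^ 2 * ∫ p in wedge (Real.tan θ) (Set.Ioi 0), ‖φ.1 (frame θ σ p)‖ ^ 2 := by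
    intro σ hσ
    have hC := IsTest.isC1_comp_frame φ.2 θ hσ
    refine (hC.robin hk hT.le).trans ?_
    gcongr
    · exact (IsC1.integrable_norm_sq hC.compact_d hC.cont_d).integrableOn
    · exact (integrable_comp_frame θ hσ (i0.add i1)).integrableOn
    · exact (measurableSet_wedge _ measurableSet_Ioi).nullMeasurableSet
    · rw [← norm_sq_rotate θ hσ (pderiv 0 φ _)]
      exact le_add_of_nonneg_left (sq_nonneg _)
  have k1 := key 1 (by norm_num)
  have k2 := key (-1) (by norm_num)
  have w1 := wedge_add_wedge_le hθ (i0.add i1) fun x => by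
    simp only [Pi.add_apply]; positivity
  have w2 := wedge_add_wedge_le hθ (integrable_norm_sq_of_memLp (IsTest.memLp φ.2))
    fun x => sq_nonneg _
  have w3 := mul_le_mul_of_nonneg_left w2 (sq_nonneg k)
  simp only [Pi.add_apply] at w1
  rw [norm_traceL2_sq, kinetic_eq, norm_toL2_sq]
  linarith

/-- The trace on `Γ` is bounded in `H¹(ℝ²)`, with a small constant in front of the kinetic energy
when `k` is large. -/
theorem trace_inequality (hθ : θ ∈ Set.Ioo 0 (Real.pi / 2)) {k : ℝ} (hk : 0 < k)
    (φ : testSpace) : k * ‖traceL2 hθ φ‖ ^ 2 ≤ kinetic φ + k ^ 2 * ‖toL2 φ‖ ^ 2 := by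
  have hT := tan_pos_of_mem hθ
  have h := robin_brokenLine hθ hk φ
  have key : ∀ σ : ℝ, σ * σ = 1 →
      ∫ s in Set.Ioi 0, Real.exp (-(k * Real.tan θ * s)) * ‖φ.1 (frame θ σ (s, 0))‖ ^ 2 ≤
      ∫ s in Set.Ioi 0, ‖φ.1 (frame θ σ (s, 0))‖ ^ 2 := by
    intro σ hσ
    have hC := IsTest.isC1_comp_frame φ.2 θ hσ
    refine setIntegral_mono_on (hC.integrable_exp_trace _).integrableOn
      hC.integrable_trace.integrableOn measurableSet_Ioi fun s hs => ?_
    have hs' : 0 < s := hs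
    exact mul_le_of_le_one_left (sq_nonneg _)
      (Real.exp_le_one_iff.2 (by have : 0 < k * Real.tan θ * s := by positivity
                                 linarith))
  have h1 := mul_le_mul_of_nonneg_left (add_le_add (key 1 (by norm_num)) (key (-1) (by norm_num)))
    hk.le
  rw [← norm_traceL2_sq hθ] at h1
  linarith

/-- Integration over a bounded measurable set in rotated coordinates is the inner product with
an element of `L²(ℝ²)`. -/
theorem exists_inner_eq_setIntegral (θ : ℝ) {σ : ℝ} (hσ : σ * σ = 1) {Q : Set (ℝ × ℝ)}
    (hQ : MeasurableSet Q) (hQ' : volume Q ≠ ⊤) :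
    ∃ g : L2Plane, ∀ φ : testSpace, inner ℂ g (toL2 φ) = ∫ p in Q, φ.1 (frame θ σ p) := by
  have he := measurableEmbedding_frame θ hσ
  have hm := measurePreserving_frame θ hσ
  have hmQ : MeasurableSet (frame θ σ '' Q) := he.measurableSet_image.2 hQ
  have hv : volume (frame θ σ '' Q) ≠ ⊤ := by
    rwa [← hm.measure_preimage hmQ.nullMeasurableSet, Set.preimage_image_eq _ he.injective]
  refine ⟨indicatorConstLp 2 hmQ hv 1, fun φ => ?_⟩
  rw [L2.inner_indicatorConstLp_one, ← hm.setIntegral_image_emb he]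
  refine setIntegral_congr_ae hmQ ?_
  filter_upwards [(IsTest.memLp φ.2).coeFn_toLp] with x hx _
  exact hx

/-- Up to finitely many linear functionals and an arbitrarily small multiple of the `H¹` norm,
the form is at least `-k² ‖φ‖²` when `α = 2 k`: the essential spectrum lies in `[-k², ∞)`. -/
theorem essential_lower_bound (hθ : θ ∈ Set.Ioo 0 (Real.pi / 2)) {k ε : ℝ} (hk : 0 < k)
    (hε : 0 < ε) : ∃ (M : ℕ) (g : Fin M ⊕ Fin M → L2Plane), ∀ φ : testSpace,
      2 * k * ‖traceL2 hθ φ‖ ^ 2 ≤ kinetic φ + k ^ 2 * ‖toL2 φ‖ ^ 2 +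
        ε * (kinetic φ + ‖toL2 φ‖ ^ 2) + ∑ i, ‖inner ℂ (g i) (toL2 φ)‖ ^ 2 := by
  have hT := tan_pos_of_mem hθ
  -- the side of the squares, small enough for the kinetic term to cost at most `ε / 2`
  set l := ε / (6 * k) with hl
  have hl0 : 0 < l := by positivity
  obtain ⟨M, hM⟩ : ∃ M : ℕ, Real.exp (-(k * Real.tan θ * (M * l))) ≤ ε / (2 * k) := by
    have h1 : Tendsto (fun M : ℕ => Real.exp (-(k * Real.tan θ * (M * l)))) atTop (𝓝 0) := by
      refine Real.tendsto_exp_neg_atTop_nhds_zero.comp ?_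
      exact (tendsto_natCast_atTop_atTop.atTop_mul_const hl0).const_mul_atTop (by positivity)
    exact (h1.eventually (ge_mem_nhds (by positivity : 0 < ε / (2 * k)))).exists
  have hQ : ∀ i : ℕ, MeasurableSet (Set.Ioc (i * l) (i * l + l) ×ˢ Set.Ioc 0 l) := fun i =>
    measurableSet_Ioc.prod measurableSet_Ioc
  have hQ' : ∀ i : ℕ, volume (Set.Ioc (i * l) (i * l + l) ×ˢ Set.Ioc 0 l) ≠ ⊤ := fun i => by
    rw [Measure.volume_eq_prod, Measure.prod_prod, Real.volume_Ioc, Real.volume_Ioc]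
    exact ENNReal.mul_ne_top ENNReal.ofReal_ne_top ENNReal.ofReal_ne_top
  choose g₁ hg₁ using fun i : ℕ =>
    exists_inner_eq_setIntegral θ (σ := 1) (by norm_num) (hQ i) (hQ' i)
  choose g₂ hg₂ using fun i : ℕ =>
    exists_inner_eq_setIntegral θ (σ := -1) (by norm_num) (hQ i) (hQ' i)
  set c : ℝ := Real.sqrt (k * (3 / l ^ 3)) with hc
  have hc2 : c ^ 2 = k * (3 / l ^ 3) := Real.sq_sqrt (by positivity)
  refine ⟨M, Sum.elim (fun i => (c : ℂ) • g₁ i) (fun i => (c : ℂ) • g₂ i), fun φ => ?_⟩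
  have hsum : ∑ i, ‖inner ℂ (Sum.elim (fun i : Fin M => (c : ℂ) • g₁ i)
      (fun i : Fin M => (c : ℂ) • g₂ i) i) (toL2 φ)‖ ^ 2 =
      k * (3 / l ^ 3 * ∑ i ∈ Finset.range M,
        ‖∫ p in Set.Ioc (i * l) (i * l + l) ×ˢ Set.Ioc 0 l, φ.1 (frame θ 1 p)‖ ^ 2) +
      k * (3 / l ^ 3 * ∑ i ∈ Finset.range M,
        ‖∫ p in Set.Ioc (i * l) (i * l + l) ×ˢ Set.Ioc 0 l, φ.1 (frame θ (-1) p)‖ ^ 2) := by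
    rw [Fintype.sum_sum_type]
    simp only [Sum.elim_inl, Sum.elim_inr, inner_smul_left, norm_mul, hg₁, hg₂, mul_pow,
      Complex.conj_ofReal, Complex.norm_real, Real.norm_eq_abs, sq_abs, hc2]
    rw [Finset.sum_range, Finset.sum_range, Finset.mul_sum, Finset.mul_sum, Finset.mul_sum,
      Finset.mul_sum]
    simp only [mul_assoc]
  have i0 := integrable_norm_sq_of_memLp (IsTest.memLp_pderiv φ.2 0)
  have i1 := integrable_norm_sq_of_memLp (IsTest.memLp_pderiv φ.2 1)
  have key : ∀ σ : ℝ, σ * σ = 1 →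
      ∫ s in Set.Ioi 0, Real.exp (-(k * Real.tan θ * s)) * ‖φ.1 (frame θ σ (s, 0))‖ ^ 2 ≤
      ε / (2 * k) * (∫ s in Set.Ioi 0, ‖φ.1 (frame θ σ (s, 0))‖ ^ 2) +
      3 * l * (∫ p in wedge (Real.tan θ) (Set.Ioi 0), (‖pderiv 0 φ (frame θ σ p)‖ ^ 2 +
        ‖pderiv 1 φ (frame θ σ p)‖ ^ 2)) +
      3 / l ^ 3 * ∑ i ∈ Finset.range M,
        ‖∫ p in Set.Ioc (i * l) (i * l + l) ×ˢ Set.Ioc 0 l, φ.1 (frame θ σ p)‖ ^ 2 := by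
    intro σ hσ
    have hC := IsTest.isC1_comp_frame φ.2 θ hσ
    have := hC.exp_trace_le hT.le (by positivity : 0 ≤ k * Real.tan θ) hl0 hM
    simpa only [norm_sq_rotate θ hσ] using this
  have k1 := mul_le_mul_of_nonneg_left (key 1 (by norm_num)) hk.le
  have k2 := mul_le_mul_of_nonneg_left (key (-1) (by norm_num)) hk.le
  have w1 := wedge_add_wedge_le hθ (i0.add i1) fun x => by
    simp only [Pi.add_apply]; positivity
  simp only [Pi.add_apply] at w1
  rw [← kinetic_eq] at w1
  have w2 := mul_le_mul_of_nonneg_left w1 (by positivity : 0 ≤ k * (3 * l))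
  have e1 : k * (3 * l) = ε / 2 := by rw [hl]; field_simp; norm_num
  have e2 : k * (ε / (2 * k)) = ε / 2 := by field_simp
  have t := mul_le_mul_of_nonneg_left (trace_inequality hθ one_pos φ)
    (by positivity : 0 ≤ ε / 2)
  have r := robin_brokenLine hθ hk φ
  have n0 : 0 ≤ ε / 2 * ‖toL2 φ‖ ^ 2 := by positivity
  rw [norm_traceL2_sq] at t
  simp only [mul_add, ← mul_assoc, e1, e2] at k1 k2 w2 t
  rw [hsum]
  simp only [mul_add, ← mul_assoc] at r ⊢
  linarith

end

/-! ### Minimizing sequences -/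

section

variable {θ : ℝ}

/-- The quadratic form of `H(θ, α)` on test functions. -/
def energy (hθ : θ ∈ Set.Ioo 0 (Real.pi / 2)) (α : ℝ) (φ : testSpace) : ℝ :=
  kinetic φ - α * ‖traceL2 hθ φ‖ ^ 2

/-- The infimum of the Rayleigh quotients of `H(θ, α)` over test functions. -/
def groundEnergy (hθ : θ ∈ Set.Ioo 0 (Real.pi / 2)) (α : ℝ) : ℝ :=
  sInf {r | ∃ φ : testSpace, toL2 φ ≠ 0 ∧ r = energy hθ α φ / ‖toL2 φ‖ ^ 2}

theorem half_kinetic_le_energy (hθ : θ ∈ Set.Ioo 0 (Real.pi / 2)) {α : ℝ} (hα : 0 < α)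
    (φ : testSpace) : kinetic φ / 2 ≤ energy hθ α φ + 2 * α ^ 2 * ‖toL2 φ‖ ^ 2 := by
  have := trace_inequality hθ (mul_pos two_pos hα) φ
  rw [energy]
  nlinarith

theorem energy_smul (hθ : θ ∈ Set.Ioo 0 (Real.pi / 2)) (α : ℝ) (c : ℂ) (φ : testSpace) :
    energy hθ α (c • φ) = ‖c‖ ^ 2 * energy hθ α φ := by
  simp only [energy, kinetic, map_smul, norm_smul, mul_pow, ← Finset.mul_sum]
  ring

theorem bddBelow_rayleigh (hθ : θ ∈ Set.Ioo 0 (Real.pi / 2)) {α : ℝ} (hα : 0 < α) :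
    BddBelow {r | ∃ φ : testSpace, toL2 φ ≠ 0 ∧ r = energy hθ α φ / ‖toL2 φ‖ ^ 2} := by
  refine ⟨-(2 * α ^ 2), ?_⟩
  rintro r ⟨φ, hφ, rfl⟩
  have h0 : 0 < ‖toL2 φ‖ := norm_pos_iff.2 hφ
  rw [le_div_iff₀ (by positivity)]
  have := half_kinetic_le_energy hθ hα φ
  have := kinetic_nonneg φ
  linarith

theorem groundEnergy_le (hθ : θ ∈ Set.Ioo 0 (Real.pi / 2)) {α : ℝ} (hα : 0 < α)
    (φ : testSpace) : groundEnergy hθ α * ‖toL2 φ‖ ^ 2 ≤ energy hθ α φ := by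
  by_cases h : toL2 φ = 0
  · have := half_kinetic_le_energy hθ hα φ
    have := kinetic_nonneg φ
    simp only [h, norm_zero] at *
    linarith
  · have h0 : 0 < ‖toL2 φ‖ := norm_pos_iff.2 h
    rw [← le_div_iff₀ (by positivity)]
    exact csInf_le (bddBelow_rayleigh hθ hα) ⟨φ, h, rfl⟩

/-- By the parallelogram law, a nonnegative quadratic form is small on differences of vectors on
which it is small. -/
theorem excess_sub_le (hθ : θ ∈ Set.Ioo 0 (Real.pi / 2)) {α E : ℝ}
    (hE : ∀ φ, E * ‖toL2 φ‖ ^ 2 ≤ energy hθ α φ) (φ ψ : testSpace) :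
    energy hθ α (φ - ψ) - E * ‖toL2 (φ - ψ)‖ ^ 2 ≤
      2 * (energy hθ α φ - E * ‖toL2 φ‖ ^ 2) + 2 * (energy hθ α ψ - E * ‖toL2 ψ‖ ^ 2) := by
  have h := hE (φ + ψ)
  have hp : ∀ {F : Type} [NormedAddCommGroup F] [InnerProductSpace ℂ F]
      (A : testSpace →ₗ[ℂ] F), ‖A (φ + ψ)‖ ^ 2 + ‖A (φ - ψ)‖ ^ 2 =
        2 * (‖A φ‖ ^ 2 + ‖A ψ‖ ^ 2) := by
    intro F _ _ A
    have := parallelogram_law_with_norm ℂ (A φ) (A ψ)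
    rw [map_add, map_sub]
    exact this
  have h1 := hp toL2
  have h2 := hp (traceL2 hθ)
  have h3 := hp (gradL2 0)
  have h4 := hp (gradL2 1)
  simp only [energy, kinetic, Fin.sum_univ_two] at h ⊢
  have h1' := congrArg (fun t => E * t) h1
  have h2' := congrArg (fun t => α * t) h2
  linarith

theorem cauchySeq_of_norm_sub_sq_le {F : Type*} [NormedAddCommGroup F] {s : ℕ → F}
    {e : ℕ × ℕ → ℝ} (h : ∀ n, ‖s n.1 - s n.2‖ ^ 2 ≤ e n) (he : Tendsto e atTop (𝓝 0)) :
    CauchySeq s := by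
  rw [cauchySeq_iff_tendsto_dist_atTop_0]
  have h1 : Tendsto (fun n : ℕ × ℕ => ‖s n.1 - s n.2‖ ^ 2) atTop (𝓝 0) :=
    squeeze_zero (fun _ => sq_nonneg _) h he
  have h2 := h1.sqrt
  simpa [dist_eq_norm, Real.sqrt_sq (norm_nonneg _)] using h2

/-- If the infimum of the form lies below `-α² / 4`, there is a minimizing sequence that converges
in the form domain. Only the finitely many linear functionals of `essential_lower_bound` have to
be controlled by compactness. -/
theorem exists_cauchy_minimizing (hθ : θ ∈ Set.Ioo 0 (Real.pi / 2)) {α : ℝ} (hα : 0 < α)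
    (hlt : groundEnergy hθ α < -(α / 2) ^ 2) :
    ∃ φ : ℕ → testSpace, (∀ n, ‖toL2 (φ n)‖ = 1) ∧
      Tendsto (fun n => energy hθ α (φ n)) atTop (𝓝 (groundEnergy hθ α)) ∧
      CauchySeq (fun n => toL2 (φ n)) ∧ (∀ j, CauchySeq fun n => gradL2 j (φ n)) ∧
      CauchySeq (fun n => traceL2 hθ (φ n)) := by
  set E := groundEnergy hθ α with hE
  have hlow := groundEnergy_le hθ hα
  rw [← hE] at hlow
  -- the infimum is negative, so it is not the junk value of the empty set
  have hne : {r | ∃ φ : testSpace, toL2 φ ≠ 0 ∧ r = energy hθ α φ / ‖toL2 φ‖ ^ 2}.Nonempty := by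
    by_contra h
    rw [Set.not_nonempty_iff_eq_empty] at h
    rw [groundEnergy, h, Real.sInf_empty] at hE
    nlinarith [sq_nonneg (α / 2)]
  have hmin : ∀ n : ℕ, ∃ φ : testSpace, ‖toL2 φ‖ = 1 ∧ energy hθ α φ < E + 1 / ((n : ℝ) + 1) := by
    intro n
    obtain ⟨r, ⟨φ, hφ, rfl⟩, hr⟩ := exists_lt_of_csInf_lt hne
      (show sInf _ < E + 1 / ((n : ℝ) + 1) from lt_add_of_pos_right _ (by positivity))
    have h0 : 0 < ‖toL2 φ‖ := norm_pos_iff.2 hφ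
    have hc : ‖((‖toL2 φ‖⁻¹ : ℝ) : ℂ)‖ = ‖toL2 φ‖⁻¹ := by
      rw [Complex.norm_real, Real.norm_of_nonneg (by positivity)]
    refine ⟨((‖toL2 φ‖⁻¹ : ℝ) : ℂ) • φ, ?_, ?_⟩
    · rw [map_smul, norm_smul, hc, inv_mul_cancel₀ h0.ne']
    · rw [energy_smul, hc, inv_pow, inv_mul_eq_div]
      exact hr
  choose φ hφ1 hφ2 using hmin
  have hconv : Tendsto (fun n => energy hθ α (φ n)) atTop (𝓝 E) := by
    have h1 : Tendsto (fun n : ℕ => E + 1 / ((n : ℝ) + 1)) atTop (𝓝 E) := by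
      simpa using tendsto_one_div_add_atTop_nhds_zero_nat.const_add E
    refine tendsto_of_tendsto_of_tendsto_of_le_of_le tendsto_const_nhds h1 (fun n => ?_)
      fun n => (hφ2 n).le
    have := hlow (φ n)
    rwa [hφ1, one_pow, mul_one] at this
  -- the constant `ε` makes the error term absorb at most half of the spectral gap `η`
  set η := -(α / 2) ^ 2 - E with hη
  have hη0 : 0 < η := by linarith
  set ε := η / (2 * (4 * α ^ 2 + 1)) with hε
  have hε0 : 0 < ε := by positivity
  obtain ⟨M, g, hg⟩ := essential_lower_bound hθ (half_pos hα) hε0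
  have hgap : ∀ ψ : testSpace, ‖toL2 ψ‖ ^ 2 ≤ 2 / η * ((1 + 2 * ε) *
      (energy hθ α ψ - E * ‖toL2 ψ‖ ^ 2) + ∑ i, ‖inner ℂ (g i) (toL2 ψ)‖ ^ 2) := by
    intro ψ
    have h1 := hg ψ
    have h2 := half_kinetic_le_energy hθ hα ψ
    have hE0 : E < 0 := by nlinarith [sq_nonneg (α / 2)]
    have h3 : kinetic ψ ≤ 2 * (energy hθ α ψ - E * ‖toL2 ψ‖ ^ 2) +
        4 * α ^ 2 * ‖toL2 ψ‖ ^ 2 := by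
      have := mul_nonneg (neg_nonneg.2 hE0.le) (sq_nonneg ‖toL2 ψ‖)
      linarith
    have h4 : ε * (kinetic ψ + ‖toL2 ψ‖ ^ 2) ≤ ε * (2 * (energy hθ α ψ - E * ‖toL2 ψ‖ ^ 2) +
        (4 * α ^ 2 + 1) * ‖toL2 ψ‖ ^ 2) := by
      exact mul_le_mul_of_nonneg_left (by linarith) hε0.le
    have h5 : ε * (4 * α ^ 2 + 1) = η / 2 := by rw [hε]; field_simp
    have h6 : kinetic ψ = energy hθ α ψ + α * ‖traceL2 hθ ψ‖ ^ 2 := by rw [energy]; ring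
    have h7 : η / 2 * ‖toL2 ψ‖ ^ 2 ≤ (1 + 2 * ε) *
      (energy hθ α ψ - E * ‖toL2 ψ‖ ^ 2) + ∑ i, ‖inner ℂ (g i) (toL2 ψ)‖ ^ 2 := by
      have h8 : ε * ((4 * α ^ 2 + 1) * ‖toL2 ψ‖ ^ 2) = η / 2 * ‖toL2 ψ‖ ^ 2 := by
        rw [← mul_assoc, h5]
      have h9 : η * ‖toL2 ψ‖ ^ 2 = -(α / 2) ^ 2 * ‖toL2 ψ‖ ^ 2 - E * ‖toL2 ψ‖ ^ 2 := by
        rw [hη]; ring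
      have h10 : 2 * (α / 2) * ‖traceL2 hθ ψ‖ ^ 2 = α * ‖traceL2 hθ ψ‖ ^ 2 := by ring
      rw [h10] at h1
      linarith
    rw [div_mul_eq_mul_div, le_div_iff₀ hη0]
    linarith
  obtain ⟨a, -, ν, hν, ha⟩ := tendsto_subseq_of_bounded (s := {b : Fin M ⊕ Fin M → ℂ |
      ∀ i, ‖b i‖ ≤ ‖g i‖}) (x := fun n i => inner ℂ (g i) (toL2 (φ n)))
    (by
      refine (Metric.isBounded_closedBall (x := 0) (r := ∑ i, ‖g i‖)).subset fun b hb => ?_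
      rw [mem_closedBall_zero_iff, pi_norm_le_iff_of_nonneg (by positivity)]
      exact fun i => (hb i).trans
        (Finset.single_le_sum (f := fun i => ‖g i‖) (fun _ _ => norm_nonneg _) (Finset.mem_univ i)))
    (fun n i => by
      have := norm_inner_le_norm (𝕜 := ℂ) (g i) (toL2 (φ n))
      rwa [hφ1, mul_one] at this)
  have hfst : Tendsto (fun n : ℕ × ℕ => n.1) atTop atTop := by
    rw [← prod_atTop_atTop_eq]; exact tendsto_fst
  have hsnd : Tendsto (fun n : ℕ × ℕ => n.2) atTop atTop := by
    rw [← prod_atTop_atTop_eq]; exact tendsto_snd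
  have hP : Tendsto (fun n : ℕ × ℕ => energy hθ α (φ (ν n.1) - φ (ν n.2)) -
      E * ‖toL2 (φ (ν n.1) - φ (ν n.2))‖ ^ 2) atTop (𝓝 0) := by
    have hx : Tendsto (fun n => energy hθ α (φ (ν n)) - E * ‖toL2 (φ (ν n))‖ ^ 2) atTop (𝓝 0) := by
      simp only [hφ1, one_pow, mul_one]
      simpa using (hconv.comp hν.tendsto_atTop).sub_const E
    refine squeeze_zero (fun n => sub_nonneg.2 (hlow _))
      (fun n => excess_sub_le hθ hlow (φ (ν n.1)) (φ (ν n.2))) ?_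
    simpa using ((hx.comp hfst).const_mul 2).add ((hx.comp hsnd).const_mul 2)
  have hF : Tendsto (fun n : ℕ × ℕ =>
      ∑ i, ‖inner ℂ (g i) (toL2 (φ (ν n.1) - φ (ν n.2)))‖ ^ 2) atTop (𝓝 0) := by
    have h0 : (0 : ℝ) = ∑ i, ‖a i - a i‖ ^ 2 := by simp
    rw [h0]
    refine tendsto_finsetSum _ fun i _ => ?_
    simp only [map_sub, inner_sub_right]
    have hi := (tendsto_pi_nhds.1 ha) i
    exact (((hi.comp hfst).sub (hi.comp hsnd)).norm).pow 2
  have hN : Tendsto (fun n : ℕ × ℕ => ‖toL2 (φ (ν n.1) - φ (ν n.2))‖ ^ 2) atTop (𝓝 0) := by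
    refine squeeze_zero (fun _ => sq_nonneg _) (fun n => hgap _) ?_
    simpa using ((hP.const_mul (1 + 2 * ε)).add hF).const_mul (2 / η)
  have hK : Tendsto (fun n : ℕ × ℕ => kinetic (φ (ν n.1) - φ (ν n.2))) atTop (𝓝 0) := by
    refine squeeze_zero (fun _ => kinetic_nonneg _) (fun n => ?_) (g := fun n =>
      2 * (energy hθ α (φ (ν n.1) - φ (ν n.2)) - E * ‖toL2 (φ (ν n.1) - φ (ν n.2))‖ ^ 2) +
        (2 * E + 4 * α ^ 2) * ‖toL2 (φ (ν n.1) - φ (ν n.2))‖ ^ 2) ?_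
    · have := half_kinetic_le_energy hθ hα (φ (ν n.1) - φ (ν n.2))
      linarith
    · simpa using (hP.const_mul 2).add (hN.const_mul (2 * E + 4 * α ^ 2))
  refine ⟨fun n => φ (ν n), fun n => hφ1 _, hconv.comp hν.tendsto_atTop, ?_, fun j => ?_, ?_⟩
  · exact cauchySeq_of_norm_sub_sq_le (fun n => by rw [← map_sub]) hN
  · refine cauchySeq_of_norm_sub_sq_le (fun n => ?_) hK
    rw [← map_sub]
    exact Finset.single_le_sum (f := fun j => ‖gradL2 j (φ (ν n.1) - φ (ν n.2))‖ ^ 2)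
      (fun _ _ => sq_nonneg _) (Finset.mem_univ j)
  · have hKN := hK.add hN
    rw [add_zero] at hKN
    refine cauchySeq_of_norm_sub_sq_le (fun n => ?_) hKN
    rw [← map_sub]
    have := trace_inequality hθ one_pos (φ (ν n.1) - φ (ν n.2))
    rwa [one_mul, one_pow, one_mul] at this

end

/-! ### A trial function and its approximation by test functions -/

section

/-- A smooth approximation of `|t|`, equal to `|t|` when `e = 0`. -/
def softAbs (e t : ℝ) : ℝ := √(t ^ 2 + e ^ 2)

/-- The derivative of `softAbs e`; for `e = 0` it is the sign, with value `0` at `0`. -/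
def softSign (e t : ℝ) : ℝ := t / √(t ^ 2 + e ^ 2)

theorem abs_le_softAbs (e t : ℝ) : |t| ≤ softAbs e t :=
  Real.abs_le_sqrt (by nlinarith [sq_nonneg e])

theorem abs_softSign_le (e t : ℝ) : |softSign e t| ≤ 1 := by
  rw [softSign, abs_div, abs_of_nonneg (Real.sqrt_nonneg _)]
  exact div_le_one_of_le₀ (abs_le_softAbs e t) (Real.sqrt_nonneg _)

theorem hasDerivAt_softAbs {e : ℝ} (he : 0 < e) {f : ℝ → ℝ} {f' t : ℝ} (hf : HasDerivAt f f' t) :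
    HasDerivAt (fun t => softAbs e (f t)) (softSign e (f t) * f') t := by
  have h := ((hf.pow 2).add_const (e ^ 2)).sqrt
    (by simp only [Pi.pow_apply]; positivity)
  refine h.congr_deriv ?_
  simp only [Nat.cast_ofNat, Nat.add_one_sub_one, pow_one, Pi.pow_apply, softSign]
  field_simp

theorem contDiff_softAbs {E : Type*} [NormedAddCommGroup E] [NormedSpace ℝ E] {e : ℝ}
    (he : 0 < e) {f : E → ℝ} (hf : ContDiff ℝ ∞ f) : ContDiff ℝ ∞ fun x => softAbs e (f x) :=
  ((hf.pow 2).add contDiff_const).sqrt fun x => by positivity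

theorem tendsto_softAbs {e t : ℕ → ℝ} {t₀ : ℝ} (he : Tendsto e atTop (𝓝 0))
    (ht : Tendsto t atTop (𝓝 t₀)) : Tendsto (fun n => softAbs (e n) (t n)) atTop (𝓝 |t₀|) := by
  have h := ((ht.pow 2).add (he.pow 2)).sqrt
  simpa [softAbs, Real.sqrt_sq_eq_abs] using h

theorem tendsto_softSign {e t : ℕ → ℝ} {t₀ : ℝ} (he : Tendsto e atTop (𝓝 0))
    (ht : Tendsto t atTop (𝓝 t₀)) (h0 : t₀ ≠ 0) :
    Tendsto (fun n => softSign (e n) (t n)) atTop (𝓝 (t₀ / |t₀|)) :=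
  ht.div (tendsto_softAbs he ht) (abs_ne_zero.2 h0)

/-- The smoothed coordinate along the nearer ray of the point `(x, y)`. -/
def along (θ e x y : ℝ) : ℝ := x * Real.cos θ + softAbs e y * Real.sin θ

/-- The smoothed signed distance of the point `(x, y)` from the line through the nearer ray. -/
def across (θ e x y : ℝ) : ℝ := softAbs e y * Real.cos θ - x * Real.sin θ

/-- The smoothed exponent of the trial function. For `e = 0` it is `|d| + max (δ s) (-ρ s)`, where
`s` and `d` are the coordinates along and across the nearer ray. -/
def trialExponent (θ δ ρ e x y : ℝ) : ℝ :=
  softAbs e (across θ e x y) + (δ - ρ) / 2 * along θ e x y +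
    (δ + ρ) / 2 * softAbs e (along θ e x y)

/-- The derivative of `trialExponent` in the direction `(v, w)`. -/
def trialExponentDeriv (θ δ ρ e x y v w : ℝ) : ℝ :=
  softSign e (across θ e x y) * (softSign e y * w * Real.cos θ - v * Real.sin θ) +
    (δ - ρ) / 2 * (v * Real.cos θ + softSign e y * w * Real.sin θ) +
    (δ + ρ) / 2 * (softSign e (along θ e x y) * (v * Real.cos θ + softSign e y * w * Real.sin θ))

theorem hasDerivAt_trialExponent (θ δ ρ : ℝ) {e : ℝ} (he : 0 < e) {f g : ℝ → ℝ} {v w t : ℝ}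
    (hf : HasDerivAt f v t) (hg : HasDerivAt g w t) :
    HasDerivAt (fun t => trialExponent θ δ ρ e (f t) (g t))
      (trialExponentDeriv θ δ ρ e (f t) (g t) v w) t := by
  have hY := hasDerivAt_softAbs he hg
  have hs : HasDerivAt (fun t => along θ e (f t) (g t)) _ t :=
    (hf.mul_const (Real.cos θ)).add (hY.mul_const (Real.sin θ))
  have hd : HasDerivAt (fun t => across θ e (f t) (g t)) _ t :=
    (hY.mul_const (Real.cos θ)).sub (hf.mul_const (Real.sin θ))
  exact ((hasDerivAt_softAbs he hd).add (hs.const_mul _)).add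
    ((hasDerivAt_softAbs he hs).const_mul _)

theorem contDiff_trialExponent (θ δ ρ : ℝ) {e : ℝ} (he : 0 < e) :
    ContDiff ℝ ∞ fun x : Plane => trialExponent θ δ ρ e (x 0) (x 1) := by
  have h0 : ContDiff ℝ ∞ fun x : Plane => x 0 := by fun_prop
  have h1 : ContDiff ℝ ∞ fun x : Plane => x 1 := by fun_prop
  have hY := contDiff_softAbs he h1
  have hs : ContDiff ℝ ∞ fun x : Plane => along θ e (x 0) (x 1) :=
    (h0.mul contDiff_const).add (hY.mul contDiff_const)
  have hd : ContDiff ℝ ∞ fun x : Plane => across θ e (x 0) (x 1) :=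
    (hY.mul contDiff_const).sub (h0.mul contDiff_const)
  exact ((contDiff_softAbs he hd).add (contDiff_const.mul hs)).add
    (contDiff_const.mul (contDiff_softAbs he hs))

theorem le_trialExponent (θ : ℝ) {δ ρ c : ℝ} (hc : 0 ≤ c) (hc1 : c ≤ 1) (hδ : c ≤ δ) (hρ : c ≤ ρ)
    (e : ℝ) (x : Plane) : c * ‖x‖ ≤ trialExponent θ δ ρ e (x 0) (x 1) := by
  set s := along θ e (x 0) (x 1) with hs
  set d := across θ e (x 0) (x 1) with hd
  have h1 : ‖x‖ ≤ |s| + |d| := by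
    have h2 : s ^ 2 + d ^ 2 = x 0 ^ 2 + softAbs e (x 1) ^ 2 := by
      rw [hs, hd, along, across]
      linear_combination (x 0 ^ 2 + softAbs e (x 1) ^ 2) * Real.sin_sq_add_cos_sq θ
    have h3 : ‖x‖ ^ 2 ≤ s ^ 2 + d ^ 2 := by
      rw [EuclideanSpace.norm_sq_eq, Fin.sum_univ_two, h2, softAbs, Real.sq_sqrt (by positivity)]
      simp only [Real.norm_eq_abs, sq_abs]
      nlinarith [sq_nonneg e]
    refine abs_le_of_sq_le_sq' ?_ (by positivity) |>.2
    nlinarith [sq_abs s, sq_abs d, mul_nonneg (abs_nonneg s) (abs_nonneg d)]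
  have h4 := abs_le_softAbs e d
  have h5 : (δ + ρ) / 2 * |s| ≤ (δ + ρ) / 2 * softAbs e s :=
    mul_le_mul_of_nonneg_left (abs_le_softAbs e s) (by linarith)
  have h6 : c * |s| ≤ (δ - ρ) / 2 * s + (δ + ρ) / 2 * |s| := by
    rcases abs_cases s with ⟨h, h'⟩ | ⟨h, h'⟩ <;> rw [h] <;> nlinarith
  have h7 : c * |d| ≤ |d| := mul_le_of_le_one_left (abs_nonneg _) hc1
  have h8 := mul_le_mul_of_nonneg_left h1 hc
  rw [trialExponent, ← hs, ← hd]
  linarith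

theorem abs_trialExponentDeriv_le (θ : ℝ) {δ ρ : ℝ} (hδ : 0 ≤ δ) (hρ : 0 ≤ ρ) (e x y : ℝ)
    {v w : ℝ} (hv : |v| ≤ 1) (hw : |w| ≤ 1) :
    |trialExponentDeriv θ δ ρ e x y v w| ≤ 2 + 2 * (δ + ρ) := by
  have hc := Real.abs_cos_le_one θ
  have hs := Real.abs_sin_le_one θ
  have hm : ∀ {a b : ℝ}, |a| ≤ 1 → |b| ≤ 1 → |a * b| ≤ 1 := fun ha hb => by
    rw [abs_mul]; exact mul_le_one₀ ha (abs_nonneg _) hb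
  have hY := hm (abs_softSign_le e y) hw
  have h1 : |softSign e y * w * Real.cos θ - v * Real.sin θ| ≤ 2 :=
    (abs_sub _ _).trans (by linarith [hm hY hc, hm hv hs])
  have h2 : |v * Real.cos θ + softSign e y * w * Real.sin θ| ≤ 2 :=
    (abs_add_le _ _).trans (by linarith [hm hv hc, hm hY hs])
  have h3 : |(δ - ρ) / 2| ≤ (δ + ρ) / 2 := abs_le.2 ⟨by linarith, by linarith⟩
  have h4 : |(δ + ρ) / 2| = (δ + ρ) / 2 := abs_of_nonneg (by linarith)
  have k1 := mul_le_mul (abs_softSign_le e (across θ e x y)) h1 (abs_nonneg _) zero_le_one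
  have k2 := mul_le_mul h3 h2 (abs_nonneg _) (by linarith)
  have k3 := mul_le_mul (abs_softSign_le e (along θ e x y)) h2 (abs_nonneg _) zero_le_one
  have k4 := mul_le_mul_of_nonneg_left k3 (by linarith : 0 ≤ (δ + ρ) / 2)
  rw [trialExponentDeriv]
  refine (abs_add_three _ _ _).trans ?_
  rw [abs_mul, abs_mul, abs_mul, abs_mul, h4]
  linarith

/-- A smooth cutoff function, equal to `1` near the origin. -/
def cutoff : ContDiffBump (0 : Plane) := ⟨1, 2, one_pos, one_lt_two⟩

theorem exists_fderiv_cutoff_le : ∃ M : ℝ, 0 ≤ M ∧ ∀ x, ‖fderiv ℝ cutoff x‖ ≤ M := by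
  obtain ⟨M, hM⟩ := (cutoff.contDiff.continuous_fderiv (n := ∞)
    (by simp)).bounded_above_of_compact_support (cutoff.hasCompactSupport.fderiv (𝕜 := ℝ))
  exact ⟨M, (norm_nonneg _).trans (hM 0), hM⟩

/-- The smoothing parameter, and the inverse radius of the cutoff, in the approximation of the
trial function by test functions. -/
def approxScale (n : ℕ) : ℝ := 1 / ((n : ℝ) + 1)

theorem approxScale_pos (n : ℕ) : 0 < approxScale n := by unfold approxScale; positivity

theorem approxScale_le_one (n : ℕ) : approxScale n ≤ 1 :=
  div_le_one_of_le₀ (by linarith [n.cast_nonneg (α := ℝ)]) (by positivity)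

theorem tendsto_approxScale : Tendsto approxScale atTop (𝓝 0) :=
  tendsto_one_div_add_atTop_nhds_zero_nat

/-- Real-valued test functions that approximate the trial function
`exp (-k (|d| + max (δ s) (-ρ s)))`. -/
def approxTrial (θ k δ ρ : ℝ) (n : ℕ) (x : Plane) : ℝ :=
  cutoff (approxScale n • x) * Real.exp (-(k * trialExponent θ δ ρ (approxScale n) (x 0) (x 1)))

/-- The partial derivative of `approxTrial` in the `j`-th coordinate direction. -/
def approxTrialDeriv (θ k δ ρ : ℝ) (j : Fin 2) (n : ℕ) (x : Plane) : ℝ :=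
  (approxScale n * fderiv ℝ cutoff (approxScale n • x) (EuclideanSpace.single j 1) -
    cutoff (approxScale n • x) * (k * trialExponentDeriv θ δ ρ (approxScale n) (x 0) (x 1)
      ((EuclideanSpace.single j 1 : Plane) 0) ((EuclideanSpace.single j 1 : Plane) 1))) *
  Real.exp (-(k * trialExponent θ δ ρ (approxScale n) (x 0) (x 1)))

theorem contDiff_approxTrial (θ k δ ρ : ℝ) (n : ℕ) : ContDiff ℝ ∞ (approxTrial θ k δ ρ n) := by
  have h1 : ContDiff ℝ ∞ fun x : Plane => cutoff (approxScale n • x) :=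
    cutoff.contDiff.comp (contDiff_const_smul _)
  exact h1.mul (contDiff_const.mul (contDiff_trialExponent θ δ ρ (approxScale_pos n))).neg.exp

theorem isTest_approxTrial (θ k δ ρ : ℝ) (n : ℕ) :
    IsTest fun x => (approxTrial θ k δ ρ n x : ℂ) := by
  refine ⟨Complex.ofRealCLM.contDiff.comp (contDiff_approxTrial θ k δ ρ n), ?_⟩
  have h2 : HasCompactSupport fun x : Plane => cutoff (approxScale n • x) :=
    cutoff.hasCompactSupport.comp_smul (approxScale_pos n).ne'
  exact HasCompactSupport.comp_left (g := fun t : ℝ => (t : ℂ)) h2.mul_right rfl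

theorem pderiv_approxTrial (θ k δ ρ : ℝ) (j : Fin 2) (n : ℕ) (x : Plane) :
    pderiv j (fun x => (approxTrial θ k δ ρ n x : ℂ)) x =
      (approxTrialDeriv θ k δ ρ j n x : ℂ) := by
  set v : Plane := EuclideanSpace.single j 1 with hv
  have hline : HasDerivAt (fun t : ℝ => x + t • v) v 0 := by
    simpa using ((hasDerivAt_id (0 : ℝ)).smul_const v).const_add x
  have hx : x + (0 : ℝ) • v = x := by simp
  have hcoord : ∀ i : Fin 2, HasDerivAt (fun t : ℝ => (x + t • v) i) (v i) 0 := by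
    intro i
    have := ((hasDerivAt_id (0 : ℝ)).mul_const (v i)).const_add (x i)
    simpa using this
  have h1 := ((isTest_approxTrial θ k δ ρ n).differentiable (x + (0 : ℝ) • v)).hasFDerivAt
    |>.comp_hasDerivAt 0 hline
  rw [hx] at h1
  have hcut : HasDerivAt (fun t : ℝ => cutoff (approxScale n • (x + t • v)))
      (fderiv ℝ cutoff (approxScale n • x) (approxScale n • v)) 0 := by
    have hd : DifferentiableAt ℝ cutoff (approxScale n • (x + (0 : ℝ) • v)) :=
      (cutoff.contDiff (n := 1)).differentiable (by simp) _
    have := hd.hasFDerivAt.comp_hasDerivAt (0 : ℝ) (hline.const_smul (approxScale n))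
    rwa [hx] at this
  have hexp := hasDerivAt_trialExponent θ δ ρ (approxScale_pos n) (hcoord 0) (hcoord 1)
  have h2 := (hcut.mul (hexp.const_mul k).neg.exp).ofReal_comp
  have h3 := h1.unique h2
  rw [pderiv, ← hv, h3]
  simp only [hx, approxTrialDeriv, Pi.neg_apply, map_smul, smul_eq_mul, ← hv]
  congr 1
  ring

variable {θ k δ ρ c M : ℝ}

theorem exp_trialExponent_le (hk : 0 < k) (hc : 0 ≤ c) (hc1 : c ≤ 1) (hδ : c ≤ δ) (hρ : c ≤ ρ)
    (e : ℝ) (x : Plane) :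
    Real.exp (-(k * trialExponent θ δ ρ e (x 0) (x 1))) ≤ Real.exp (-(k * (c * ‖x‖))) :=
  Real.exp_le_exp.2 (neg_le_neg
    (mul_le_mul_of_nonneg_left (le_trialExponent θ hc hc1 hδ hρ e x) hk.le))

theorem abs_approxTrial_le (hk : 0 < k) (hc : 0 ≤ c) (hc1 : c ≤ 1) (hδ : c ≤ δ) (hρ : c ≤ ρ)
    (n : ℕ) (x : Plane) : |approxTrial θ k δ ρ n x| ≤ Real.exp (-(k * (c * ‖x‖))) := by
  rw [approxTrial, abs_mul, abs_of_nonneg cutoff.nonneg, Real.abs_exp]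
  exact (mul_le_of_le_one_left (Real.exp_pos _).le cutoff.le_one).trans
    (exp_trialExponent_le hk hc hc1 hδ hρ _ x)

theorem abs_approxTrialDeriv_le (hM0 : 0 ≤ M) (hM : ∀ x, ‖fderiv ℝ cutoff x‖ ≤ M) (hk : 0 < k)
    (hc : 0 ≤ c) (hc1 : c ≤ 1) (hδ : c ≤ δ) (hρ : c ≤ ρ) (j : Fin 2) (n : ℕ) (x : Plane) :
    |approxTrialDeriv θ k δ ρ j n x| ≤
      (M + k * (2 + 2 * (δ + ρ))) * Real.exp (-(k * (c * ‖x‖))) := by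
  have hv : ∀ i, |(EuclideanSpace.single j (1 : ℝ) : Plane) i| ≤ 1 := by
    intro i
    rw [PiLp.single_apply]
    split_ifs <;> simp
  have h1 : |approxScale n * fderiv ℝ cutoff (approxScale n • x) (EuclideanSpace.single j 1)| ≤
      M := by
    rw [abs_mul, abs_of_pos (approxScale_pos n)]
    have h2 := (fderiv ℝ cutoff (approxScale n • x)).le_opNorm (EuclideanSpace.single j 1)
    rw [PiLp.norm_single, norm_one, mul_one] at h2
    calc _ ≤ 1 * M := mul_le_mul (approxScale_le_one n) (h2.trans (hM _)) (abs_nonneg _)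
          zero_le_one
      _ = M := one_mul M
  have h3 := abs_trialExponentDeriv_le θ (hc.trans hδ) (hc.trans hρ) (approxScale n) (x 0) (x 1)
    (hv 0) (hv 1)
  have h4 : |cutoff (approxScale n • x) * (k * trialExponentDeriv θ δ ρ (approxScale n) (x 0) (x 1)
      ((EuclideanSpace.single j 1 : Plane) 0) ((EuclideanSpace.single j 1 : Plane) 1))| ≤
      k * (2 + 2 * (δ + ρ)) := by
    rw [abs_mul, abs_mul, abs_of_nonneg cutoff.nonneg, abs_of_pos hk]
    exact (mul_le_of_le_one_left (by positivity) cutoff.le_one).trans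
      (mul_le_mul_of_nonneg_left h3 hk.le)
  rw [approxTrialDeriv, abs_mul, Real.abs_exp]
  refine mul_le_mul ((abs_sub _ _).trans (add_le_add h1 h4))
    (exp_trialExponent_le hk hc hc1 hδ hρ _ x) (Real.exp_pos _).le ?_
  have := hc.trans hδ
  have := hc.trans hρ
  positivity

/-- The trial function in the coordinates along and across a ray. -/
def trial (k δ ρ : ℝ) (p : ℝ × ℝ) : ℝ :=
  Real.exp (-(k * (|p.2| + (δ - ρ) / 2 * p.1 + (δ + ρ) / 2 * |p.1|)))

theorem frame_coords (θ σ : ℝ) (p : ℝ × ℝ) :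
    frame θ σ p 0 = p.1 * Real.cos θ - p.2 * Real.sin θ ∧
      frame θ σ p 1 = σ * (p.1 * Real.sin θ + p.2 * Real.cos θ) := ⟨rfl, rfl⟩

theorem pos_of_mem_wedge (hθ : θ ∈ Set.Ioo 0 (Real.pi / 2)) {σ : ℝ} (hσ : σ * σ = 1)
    {p : ℝ × ℝ} (hp : p ∈ wedge (Real.tan θ) Set.univ) :
    0 < p.1 * Real.sin θ + p.2 * Real.cos θ := by
  rw [← frame_preimage_halfPlane hθ hσ] at hp
  have h : 0 < σ * (σ * (p.1 * Real.sin θ + p.2 * Real.cos θ)) := hp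
  rwa [← mul_assoc, hσ, one_mul] at h

theorem tendsto_along_across {σ : ℝ} (hσ : σ * σ = 1) {p : ℝ × ℝ}
    (hp : 0 < p.1 * Real.sin θ + p.2 * Real.cos θ) :
    Tendsto (fun n => along θ (approxScale n) (frame θ σ p 0) (frame θ σ p 1)) atTop (𝓝 p.1) ∧
    Tendsto (fun n => across θ (approxScale n) (frame θ σ p 0) (frame θ σ p 1)) atTop (𝓝 p.2) := by
  obtain ⟨h0, h1⟩ := frame_coords θ σ p
  have habs : |σ| = 1 := by
    have := abs_mul_abs_self σ
    rw [hσ] at this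
    nlinarith [abs_nonneg σ]
  have hY := tendsto_softAbs tendsto_approxScale (tendsto_const_nhds (x := frame θ σ p 1))
  rw [h1, abs_mul, habs, one_mul, abs_of_pos hp] at hY
  have e1 : p.1 = (p.1 * Real.cos θ - p.2 * Real.sin θ) * Real.cos θ +
      (p.1 * Real.sin θ + p.2 * Real.cos θ) * Real.sin θ := by
    linear_combination -p.1 * Real.sin_sq_add_cos_sq θ
  have e2 : p.2 = (p.1 * Real.sin θ + p.2 * Real.cos θ) * Real.cos θ -
      (p.1 * Real.cos θ - p.2 * Real.sin θ) * Real.sin θ := by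
    linear_combination -p.2 * Real.sin_sq_add_cos_sq θ
  constructor
  · conv => arg 3; rw [e1]
    simp only [along, h0, h1]
    exact (hY.mul_const _).const_add _
  · conv => arg 3; rw [e2]
    simp only [across, h0, h1]
    exact (hY.mul_const _).sub_const _

theorem tendsto_cutoff (x : Plane) :
    Tendsto (fun n => cutoff (approxScale n • x)) atTop (𝓝 1) := by
  have h1 : Tendsto (fun n => approxScale n • x) atTop (𝓝 0) := by
    simpa using tendsto_approxScale.smul_const x
  have h2 := (cutoff.continuous.tendsto 0).comp h1
  rwa [cutoff.one_of_mem_closedBall (Metric.mem_closedBall_self cutoff.rIn_pos.le)] at h2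

theorem tendsto_exp_trialExponent {σ : ℝ} (hσ : σ * σ = 1) {p : ℝ × ℝ}
    (hp : 0 < p.1 * Real.sin θ + p.2 * Real.cos θ) :
    Tendsto (fun n => Real.exp (-(k * trialExponent θ δ ρ (approxScale n)
      (frame θ σ p 0) (frame θ σ p 1)))) atTop (𝓝 (trial k δ ρ p)) := by
  obtain ⟨hs, hd⟩ := tendsto_along_across hσ hp
  exact ((((tendsto_softAbs tendsto_approxScale hd).add (hs.const_mul _)).add
    ((tendsto_softAbs tendsto_approxScale hs).const_mul _)).const_mul k).neg.rexp

theorem tendsto_approxTrial {σ : ℝ} (hσ : σ * σ = 1) {p : ℝ × ℝ}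
    (hp : 0 < p.1 * Real.sin θ + p.2 * Real.cos θ) :
    Tendsto (fun n => approxTrial θ k δ ρ n (frame θ σ p)) atTop (𝓝 (trial k δ ρ p)) := by
  simpa [approxTrial] using (tendsto_cutoff (frame θ σ p)).mul (tendsto_exp_trialExponent hσ hp)

theorem tendsto_approxTrialDeriv {σ : ℝ} (hσ : σ * σ = 1) {p : ℝ × ℝ}
    (hp : 0 < p.1 * Real.sin θ + p.2 * Real.cos θ) (hs0 : p.1 ≠ 0) (hd0 : p.2 ≠ 0) :
    Tendsto (fun n => approxTrialDeriv θ k δ ρ 0 n (frame θ σ p) ^ 2 +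
      approxTrialDeriv θ k δ ρ 1 n (frame θ σ p) ^ 2) atTop
      (𝓝 (k ^ 2 * (1 + ((δ - ρ) / 2 + (δ + ρ) / 2 * (p.1 / |p.1|)) ^ 2) *
        trial k δ ρ p ^ 2)) := by
  obtain ⟨hs, hd⟩ := tendsto_along_across hσ hp
  have hss := tendsto_softSign tendsto_approxScale hs hs0
  have hsd := tendsto_softSign tendsto_approxScale hd hd0
  have hx1 : frame θ σ p 1 = σ * (p.1 * Real.sin θ + p.2 * Real.cos θ) := rfl
  have hσ0 : σ ≠ 0 := by rintro rfl; norm_num at hσ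
  have hsy := tendsto_softSign tendsto_approxScale (tendsto_const_nhds (x := frame θ σ p 1))
    (by rw [hx1]; exact mul_ne_zero hσ0 hp.ne')
  set x := frame θ σ p with hx
  set q := p.2 / |p.2| with hq
  set r := p.1 / |p.1| with hr
  set w := x 1 / |x 1| with hw
  have hunit : ∀ t : ℝ, t ≠ 0 → (t / |t|) ^ 2 = 1 := fun t ht => by
    rw [div_pow, sq_abs, div_self (pow_ne_zero 2 ht)]
  have hq2 : q ^ 2 = 1 := hunit _ hd0
  have hw2 : w ^ 2 = 1 := hunit _ (by rw [hx1]; exact mul_ne_zero hσ0 hp.ne')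
  have hder : ∀ v v' : ℝ, Tendsto
      (fun n => trialExponentDeriv θ δ ρ (approxScale n) (x 0) (x 1) v v') atTop
      (𝓝 (q * (w * v' * Real.cos θ - v * Real.sin θ) +
        (δ - ρ) / 2 * (v * Real.cos θ + w * v' * Real.sin θ) +
        (δ + ρ) / 2 * (r * (v * Real.cos θ + w * v' * Real.sin θ)))) := by
    intro v v'
    have hA := (((hsy.mul_const v').mul_const (Real.cos θ)).sub_const (v * Real.sin θ))
    have hB := (((hsy.mul_const v').mul_const (Real.sin θ)).const_add (v * Real.cos θ))
    exact ((hsd.mul hA).add (hB.const_mul _)).add ((hss.mul hB).const_mul _)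
  have hcut : ∀ v : Plane, Tendsto
      (fun n => approxScale n * fderiv ℝ cutoff (approxScale n • x) v) atTop (𝓝 0) := by
    intro v
    have h1 : Tendsto (fun n => approxScale n • x) atTop (𝓝 0) := by
      simpa using tendsto_approxScale.smul_const x
    have h2 : Continuous fun y => fderiv ℝ cutoff y v :=
      (cutoff.contDiff.continuous_fderiv (n := ∞) (by simp)).clm_apply continuous_const
    simpa using tendsto_approxScale.mul ((h2.tendsto 0).comp h1)
  have hj : ∀ j : Fin 2, Tendsto (fun n => approxTrialDeriv θ k δ ρ j n x) atTop _ := fun j =>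
    ((hcut (EuclideanSpace.single j 1)).sub ((tendsto_cutoff x).mul
      ((hder ((EuclideanSpace.single j 1 : Plane) 0)
        ((EuclideanSpace.single j 1 : Plane) 1)).const_mul k))).mul (tendsto_exp_trialExponent (k := k) (δ := δ) (ρ := ρ) hσ hp)
  have h := ((hj 0).pow 2).add ((hj 1).pow 2)
  convert h using 2
  simp only [PiLp.single_apply, if_true, one_ne_zero, zero_ne_one, if_false]
  have hsc := Real.sin_sq_add_cos_sq θ
  linear_combination k ^ 2 * trial k δ ρ p ^ 2 * (-(1 + ((δ - ρ) / 2 + (δ + ρ) / 2 * r) ^ 2) * hsc -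
    Real.sin θ ^ 2 * hq2 - (q * Real.cos θ + ((δ - ρ) / 2 + (δ + ρ) / 2 * r) * Real.sin θ) ^ 2 * hw2
    - Real.cos θ ^ 2 * hq2)

theorem integrable_exp_neg_mul_abs {c : ℝ} (hc : 0 < c) :
    Integrable fun t : ℝ => Real.exp (-(c * |t|)) := by
  rw [← integrableOn_univ, ← Set.Iic_union_Ioi (a := (0 : ℝ))]
  refine IntegrableOn.union ?_ ?_
  · refine (integrableOn_exp_mul_Iic hc 0).congr_fun (fun t ht => ?_) measurableSet_Iic
    simp only [abs_of_nonpos (show t ≤ 0 from ht)]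
    ring_nf
  · refine (integrableOn_exp_mul_Ioi (neg_neg_of_pos hc) 0).congr_fun (fun t ht => ?_)
      measurableSet_Ioi
    simp only [abs_of_pos (show 0 < t from ht)]
    ring_nf

theorem integrable_exp_neg_mul_abs_add_abs {c : ℝ} (hc : 0 < c) :
    Integrable fun p : ℝ × ℝ => Real.exp (-(c * (|p.1| + |p.2|))) := by
  refine ((integrable_exp_neg_mul_abs hc).mul_prod (integrable_exp_neg_mul_abs hc)).congr
    (ae_of_all _ fun p => ?_)
  simp only [← Real.exp_add]
  ring_nf

theorem exp_neg_norm_frame_sq_le {σ : ℝ} (hσ : σ * σ = 1) (hc : 0 ≤ k * c) (p : ℝ × ℝ) :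
    Real.exp (-(k * (c * ‖frame θ σ p‖))) ^ 2 ≤ Real.exp (-(k * c * (|p.1| + |p.2|))) := by
  have h : |p.1| + |p.2| ≤ 2 * ‖frame θ σ p‖ := by
    have h1 := norm_frame_sq θ hσ p
    refine abs_le_of_sq_le_sq' ?_ (by positivity) |>.2
    nlinarith [sq_abs p.1, sq_abs p.2, sq_nonneg (|p.1| - |p.2|)]
  rw [← Real.exp_nat_mul]
  refine Real.exp_le_exp.2 ?_
  have := mul_le_mul_of_nonneg_left h hc
  push_cast
  linarith

end

/-! ### The energy of the trial function -/

section

variable {θ k δ ρ : ℝ}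

/-- The approximations of the trial function, as elements of the space of test functions. -/
def approxTest (θ k δ ρ : ℝ) (n : ℕ) : testSpace :=
  ⟨fun x => (approxTrial θ k δ ρ n x : ℂ), isTest_approxTrial θ k δ ρ n⟩

theorem exists_decay (hδ : 0 < δ) (hρ : 0 < ρ) : ∃ c : ℝ, 0 < c ∧ c ≤ 1 ∧ c ≤ δ ∧ c ≤ ρ :=
  ⟨min 1 (min δ ρ), by positivity, min_le_left _ _, (min_le_right _ _).trans (min_le_left _ _),
    (min_le_right _ _).trans (min_le_right _ _)⟩

/-- Dominated convergence on the plane, in the coordinates of the two rays. -/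
theorem tendsto_integral_of_frame (hθ : θ ∈ Set.Ioo 0 (Real.pi / 2)) {g : ℕ → Plane → ℝ}
    {G : ℝ × ℝ → ℝ} {b C : ℝ} (hb : 0 < b) (hg : ∀ n, Integrable (g n))
    (hbd : ∀ n (σ : ℝ), σ * σ = 1 → ∀ p, |g n (frame θ σ p)| ≤
      C * Real.exp (-(b * (|p.1| + |p.2|))))
    (hlim : ∀ σ : ℝ, σ * σ = 1 → ∀ p ∈ wedge (Real.tan θ) Set.univ, p.1 ≠ 0 → p.2 ≠ 0 →
      Tendsto (fun n => g n (frame θ σ p)) atTop (𝓝 (G p))) :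
    Tendsto (fun n => ∫ x, g n x) atTop (𝓝 (2 * ∫ p in wedge (Real.tan θ) Set.univ, G p)) := by
  have hm := measurableSet_wedge (Real.tan θ) MeasurableSet.univ
  have h1 : ∀ᵐ p : ℝ × ℝ, p.1 ≠ 0 ∧ p.2 ≠ 0 := by
    have h0 : ∀ᵐ d : ℝ, d ≠ 0 := by simp [ae_iff]
    exact (Measure.quasiMeasurePreserving_fst.ae h0).and (Measure.quasiMeasurePreserving_snd.ae h0)
  have key : ∀ σ : ℝ, σ * σ = 1 → Tendsto (fun n => ∫ x in halfPlane σ, g n x) atTop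
      (𝓝 (∫ p in wedge (Real.tan θ) Set.univ, G p)) := by
    intro σ hσ
    simp only [setIntegral_halfPlane hθ hσ]
    refine tendsto_integral_of_dominated_convergence
      (fun p => C * Real.exp (-(b * (|p.1| + |p.2|))))
      (fun n => (integrable_comp_frame θ hσ (hg n)).integrableOn.1)
      ((integrable_exp_neg_mul_abs_add_abs hb).const_mul C).integrableOn
      (fun n => ae_of_all _ fun p => hbd n σ hσ p) ?_
    filter_upwards [ae_restrict_mem hm, ae_restrict_of_ae h1] with p hp hp0
    exact hlim σ hσ p hp hp0.1 hp0.2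
  simp only [fun n => integral_eq_add_halfPlane (hg n)]
  rw [two_mul]
  exact (key 1 (by norm_num)).add (key (-1) (by norm_num))

theorem norm_ofReal_sq (t : ℝ) : ‖(t : ℂ)‖ ^ 2 = t ^ 2 := by
  rw [Complex.norm_real, Real.norm_eq_abs, sq_abs]

theorem sq_le_of_abs_le {a C x : ℝ} (h : |a| ≤ C * x) : a ^ 2 ≤ C ^ 2 * x ^ 2 := by
  rw [← mul_pow, ← sq_abs a]
  exact pow_le_pow_left₀ (abs_nonneg _) h 2

theorem tendsto_norm_approxTest (hθ : θ ∈ Set.Ioo 0 (Real.pi / 2)) (hk : 0 < k) (hδ : 0 < δ)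
    (hρ : 0 < ρ) : Tendsto (fun n => ‖toL2 (approxTest θ k δ ρ n)‖ ^ 2) atTop
      (𝓝 (2 * ∫ p in wedge (Real.tan θ) Set.univ, trial k δ ρ p ^ 2)) := by
  obtain ⟨c, hc, hc1, hcδ, hcρ⟩ := exists_decay hδ hρ
  have he : ∀ n, ‖toL2 (approxTest θ k δ ρ n)‖ ^ 2 = ∫ x, approxTrial θ k δ ρ n x ^ 2 := fun n => by
    rw [norm_toL2_sq]
    simp only [approxTest, norm_ofReal_sq]
  simp only [he]
  refine tendsto_integral_of_frame hθ (mul_pos hk hc) (C := 1) (fun n => ?_)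
    (fun n σ hσ p => ?_) (fun σ hσ p hp _ _ => ?_)
  · have := integrable_norm_sq_of_memLp (isTest_approxTrial θ k δ ρ n).memLp
    simpa only [norm_ofReal_sq] using this
  · rw [abs_of_nonneg (sq_nonneg _), one_mul]
    refine le_trans ?_ (exp_neg_norm_frame_sq_le (θ := θ) hσ (mul_pos hk hc).le p)
    have := sq_le_of_abs_le (C := 1) (by
      simpa using abs_approxTrial_le (θ := θ) hk hc.le hc1 hcδ hcρ n (frame θ σ p))
    simpa using this
  · exact (tendsto_approxTrial hσ (pos_of_mem_wedge hθ hσ hp)).pow 2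

theorem tendsto_kinetic_approxTest (hθ : θ ∈ Set.Ioo 0 (Real.pi / 2)) (hk : 0 < k) (hδ : 0 < δ)
    (hρ : 0 < ρ) : Tendsto (fun n => kinetic (approxTest θ k δ ρ n)) atTop
      (𝓝 (2 * ∫ p in wedge (Real.tan θ) Set.univ,
        k ^ 2 * (1 + ((δ - ρ) / 2 + (δ + ρ) / 2 * (p.1 / |p.1|)) ^ 2) * trial k δ ρ p ^ 2)) := by
  obtain ⟨c, hc, hc1, hcδ, hcρ⟩ := exists_decay hδ hρ
  obtain ⟨M, hM0, hM⟩ := exists_fderiv_cutoff_le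
  have he : ∀ n, kinetic (approxTest θ k δ ρ n) =
      ∫ x, (approxTrialDeriv θ k δ ρ 0 n x ^ 2 + approxTrialDeriv θ k δ ρ 1 n x ^ 2) := fun n => by
    rw [kinetic_eq]
    simp only [approxTest, pderiv_approxTrial, norm_ofReal_sq]
  simp only [he]
  refine tendsto_integral_of_frame hθ (mul_pos hk hc) (C := 2 * (M + k * (2 + 2 * (δ + ρ))) ^ 2)
    (fun n => ?_) (fun n σ hσ p => ?_) (fun σ hσ p hp hs hd => ?_)
  · have h : ∀ j, Integrable fun x => approxTrialDeriv θ k δ ρ j n x ^ 2 := fun j => by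
      have := integrable_norm_sq_of_memLp ((isTest_approxTrial θ k δ ρ n).memLp_pderiv j)
      simpa only [pderiv_approxTrial, norm_ofReal_sq] using this
    exact (h 0).add (h 1)
  · have h : ∀ j, approxTrialDeriv θ k δ ρ j n (frame θ σ p) ^ 2 ≤
        (M + k * (2 + 2 * (δ + ρ))) ^ 2 * Real.exp (-(k * c * (|p.1| + |p.2|))) := fun j =>
      (sq_le_of_abs_le (abs_approxTrialDeriv_le (θ := θ) hM0 hM hk hc.le hc1 hcδ hcρ j n
        (frame θ σ p))).trans (mul_le_mul_of_nonneg_left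
          (exp_neg_norm_frame_sq_le hσ (mul_pos hk hc).le p) (sq_nonneg _))
    rw [abs_of_nonneg (by positivity)]
    linarith [h 0, h 1]
  · exact tendsto_approxTrialDeriv hσ (pos_of_mem_wedge hθ hσ hp) hs hd

theorem tendsto_trace_approxTest (hθ : θ ∈ Set.Ioo 0 (Real.pi / 2)) (hk : 0 < k) (hδ : 0 < δ)
    (hρ : 0 < ρ) : Tendsto (fun n => ‖traceL2 hθ (approxTest θ k δ ρ n)‖ ^ 2) atTop
      (𝓝 (2 * ∫ s in Set.Ioi 0, trial k δ ρ (s, 0) ^ 2)) := by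
  obtain ⟨c, hc, hc1, hcδ, hcρ⟩ := exists_decay hδ hρ
  have key : ∀ σ : ℝ, σ * σ = 1 → Tendsto (fun n => ∫ s in Set.Ioi 0,
      ‖(approxTest θ k δ ρ n).1 (frame θ σ (s, 0))‖ ^ 2) atTop
      (𝓝 (∫ s in Set.Ioi 0, trial k δ ρ (s, 0) ^ 2)) := by
    intro σ hσ
    simp only [approxTest, norm_ofReal_sq]
    refine tendsto_integral_of_dominated_convergence
      (fun s => Real.exp (-(k * c * |s|))) (fun n => ?_)
      (integrable_exp_neg_mul_abs (mul_pos hk hc)).integrableOn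
      (fun n => ae_of_all _ fun s => ?_) ?_
    · refine Continuous.aestronglyMeasurable ?_
      exact ((contDiff_approxTrial θ k δ ρ n).continuous.comp
        (isometry_frame_ray θ hσ).continuous).pow 2
    · rw [Real.norm_eq_abs, abs_of_nonneg (sq_nonneg _)]
      have h1 := exp_neg_norm_frame_sq_le (θ := θ) hσ (mul_pos hk hc).le (s, 0)
      simp only [abs_zero, add_zero] at h1
      refine le_trans ?_ h1
      have := sq_le_of_abs_le (C := 1) (by
        simpa using abs_approxTrial_le (θ := θ) hk hc.le hc1 hcδ hcρ n (frame θ σ (s, 0)))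
      simpa using this
    · filter_upwards [ae_restrict_mem measurableSet_Ioi] with s hs
      refine (tendsto_approxTrial hσ ?_).pow 2
      have := mul_pos (show 0 < s from hs) (sin_pos_of_mem hθ)
      simpa using this
  simp only [norm_traceL2_sq]
  rw [two_mul]
  exact (key 1 (by norm_num)).add (key (-1) (by norm_num))

theorem integral_exp_abs_of_nonneg {c L : ℝ} (hc : 0 < c) (hL : 0 ≤ L) :
    ∫ d in Set.Ioi (-L), Real.exp (-(c * |d|)) = (2 - Real.exp (-(c * L))) / c := by
  have hi := integrable_exp_neg_mul_abs hc
  rw [← Set.Ioc_union_Ioi_eq_Ioi (by linarith : -L ≤ 0), setIntegral_union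
    (Set.Ioc_disjoint_Ioi le_rfl) measurableSet_Ioi hi.integrableOn hi.integrableOn]
  have e1 : ∫ d in Set.Ioi (0 : ℝ), Real.exp (-(c * |d|)) = 1 / c := by
    rw [setIntegral_congr_fun (g := fun d => Real.exp (-c * d)) measurableSet_Ioi fun d hd => by
      simp only [abs_of_pos (show 0 < d from hd)]; ring_nf, integral_exp_mul_Ioi (by linarith)]
    simp
  have e2 : ∫ d in Set.Ioc (-L) 0, Real.exp (-(c * |d|)) = (1 - Real.exp (-(c * L))) / c := by
    rw [setIntegral_congr_fun (g := fun d => Real.exp (c * d)) measurableSet_Ioc fun d hd => by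
      simp only [abs_of_nonpos hd.2]; ring_nf,
      ← intervalIntegral.integral_of_le (by linarith),
      ← intervalIntegral.integral_Iic_sub_Iic (integrableOn_exp_mul_Iic hc _)
        (integrableOn_exp_mul_Iic hc _), integral_exp_mul_Iic hc, integral_exp_mul_Iic hc]
    simp only [mul_zero, Real.exp_zero, mul_neg]
    ring
  rw [e1, e2]
  ring

theorem integral_exp_abs_of_nonpos {c L : ℝ} (hc : 0 < c) (hL : L ≤ 0) :
    ∫ d in Set.Ioi (-L), Real.exp (-(c * |d|)) = Real.exp (c * L) / c := by
  rw [setIntegral_congr_fun (g := fun d => Real.exp (-c * d)) measurableSet_Ioi fun d hd => by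
      have : -L < d := hd
      simp only [abs_of_nonneg (by linarith : 0 ≤ d)]; ring_nf, integral_exp_mul_Ioi (by linarith)]
  rw [neg_mul_neg, neg_div_neg_eq]

theorem trial_sq (k δ ρ s d : ℝ) : trial k δ ρ (s, d) ^ 2 =
    Real.exp (-(2 * k * ((δ - ρ) / 2 * s + (δ + ρ) / 2 * |s|))) * Real.exp (-(2 * k * |d|)) := by
  rw [trial, ← Real.exp_nat_mul, ← Real.exp_add]
  congr 1
  push_cast
  ring

theorem continuous_trial (k δ ρ : ℝ) : Continuous (trial k δ ρ) := by
  unfold trial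
  fun_prop

theorem integrable_trial_sq (hk : 0 < k) (hδ : 0 < δ) (hρ : 0 < ρ) :
    Integrable fun p => trial k δ ρ p ^ 2 := by
  obtain ⟨c, hc, hc1, hcδ, hcρ⟩ := exists_decay hδ hρ
  refine (integrable_exp_neg_mul_abs_add_abs (mul_pos (mul_pos two_pos hk) hc)).mono'
    ((continuous_trial k δ ρ).pow 2).aestronglyMeasurable (ae_of_all _ fun p => ?_)
  rw [Real.norm_eq_abs, abs_of_nonneg (sq_nonneg _), trial_sq, ← Real.exp_add]
  refine Real.exp_le_exp.2 ?_
  have h1 : c * |p.1| ≤ (δ - ρ) / 2 * p.1 + (δ + ρ) / 2 * |p.1| := by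
    rcases abs_cases p.1 with ⟨h, h'⟩ | ⟨h, h'⟩ <;> rw [h] <;> nlinarith
  have h2 : c * |p.2| ≤ |p.2| := mul_le_of_le_one_left (abs_nonneg _) hc1
  nlinarith

theorem integral_trace_trial (hk : 0 < k) (hδ : 0 < δ) :
    ∫ s in Set.Ioi 0, trial k δ ρ (s, 0) ^ 2 = 1 / (2 * k * δ) := by
  rw [setIntegral_congr_fun (g := fun s => Real.exp (-(2 * k * δ) * s)) measurableSet_Ioi
    fun s hs => by
      simp only [trial_sq, abs_of_pos (show 0 < s from hs), abs_zero, mul_zero, neg_zero,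
        Real.exp_zero, mul_one]
      ring_nf, integral_exp_mul_Ioi (by have : 0 < 2 * k * δ := by positivity
                                        linarith)]
  simp

theorem integral_trial_pos {T : ℝ} (hk : 0 < k) (hδ : 0 < δ) (hρ : 0 < ρ) (hT : 0 < T) :
    ∫ p in wedge T (Set.Ioi 0), trial k δ ρ p ^ 2 =
      (1 / (2 * δ) - 1 / (4 * (T + δ))) / k ^ 2 := by
  rw [setIntegral_wedge T measurableSet_Ioi (integrable_trial_sq hk hδ hρ).integrableOn]
  rw [setIntegral_congr_fun (g := fun s => 1 / k * Real.exp (-(2 * k * δ) * s) -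
    1 / (2 * k) * Real.exp (-(2 * k * (T + δ)) * s)) measurableSet_Ioi fun s hs => by
      have hs' : 0 < s := hs
      simp only [trial_sq, integral_const_mul]
      rw [integral_exp_abs_of_nonneg (by positivity) (by positivity), abs_of_pos hs',
        show -(2 * k * (T + δ)) * s = -(2 * k * δ) * s + -(2 * k * (T * s)) by ring, Real.exp_add,
        show -(2 * k * ((δ - ρ) / 2 * s + (δ + ρ) / 2 * s)) = -(2 * k * δ) * s by ring]
      field_simp]
  have n1 : -(2 * k * δ) < 0 := by have : 0 < 2 * k * δ := by positivity
                                   linarith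
  have n2 : -(2 * k * (T + δ)) < 0 := by have : 0 < 2 * k * (T + δ) := by positivity
                                         linarith
  rw [integral_sub ((integrableOn_exp_mul_Ioi n1 0).const_mul _)
    ((integrableOn_exp_mul_Ioi n2 0).const_mul _), integral_const_mul, integral_const_mul,
    integral_exp_mul_Ioi n1, integral_exp_mul_Ioi n2]
  simp only [mul_zero, Real.exp_zero]
  field_simp
  ring

theorem integral_trial_neg {T : ℝ} (hk : 0 < k) (hδ : 0 < δ) (hρ : 0 < ρ) (hT : 0 < T) :
    ∫ p in wedge T (Set.Iic 0), trial k δ ρ p ^ 2 = 1 / (4 * (T + ρ)) / k ^ 2 := by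
  rw [setIntegral_wedge T measurableSet_Iic (integrable_trial_sq hk hδ hρ).integrableOn]
  rw [setIntegral_congr_fun (g := fun s => 1 / (2 * k) * Real.exp (2 * k * (T + ρ) * s))
    measurableSet_Iic fun s hs => by
      have hs' : s ≤ 0 := hs
      simp only [trial_sq, integral_const_mul]
      rw [integral_exp_abs_of_nonpos (by positivity) (mul_nonpos_of_nonneg_of_nonpos hT.le hs'),
        abs_of_nonpos hs',
        show 2 * k * (T + ρ) * s = -(2 * k * ((δ - ρ) / 2 * s + (δ + ρ) / 2 * -s)) +
          2 * k * (T * s) by ring, Real.exp_add]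
      field_simp]
  rw [integral_const_mul, integral_exp_mul_Iic (by positivity)]
  simp only [mul_zero, Real.exp_zero]
  field_simp
  norm_num

theorem setIntegral_wedge_univ {T : ℝ} {G : ℝ × ℝ → ℝ}
    (h1 : IntegrableOn G (wedge T (Set.Ioi 0))) (h2 : IntegrableOn G (wedge T (Set.Iic 0))) :
    ∫ p in wedge T Set.univ, G p =
      (∫ p in wedge T (Set.Ioi 0), G p) + ∫ p in wedge T (Set.Iic 0), G p := by
  rw [← setIntegral_union ?_ (measurableSet_wedge T measurableSet_Iic) h1 h2]
  · congr 2
    ext p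
    simp only [wedge, Set.mem_union, Set.mem_ofPred_eq, Set.mem_univ, Set.mem_Ioi, Set.mem_Iic,
      ← or_and_right, lt_or_ge, and_iff_right]
  · exact Set.disjoint_left.2 fun p hp hp' => absurd (show 0 < p.1 from hp.1) (not_lt.2 hp'.1)

theorem integral_kinetic_trial {T : ℝ} (hk : 0 < k) (hδ : 0 < δ) (hρ : 0 < ρ) (hT : 0 < T) :
    ∫ p in wedge T Set.univ,
        k ^ 2 * (1 + ((δ - ρ) / 2 + (δ + ρ) / 2 * (p.1 / |p.1|)) ^ 2) * trial k δ ρ p ^ 2 =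
      (1 + δ ^ 2) * (1 / (2 * δ) - 1 / (4 * (T + δ))) + (1 + ρ ^ 2) * (1 / (4 * (T + ρ))) := by
  set G : ℝ × ℝ → ℝ := fun p =>
    k ^ 2 * (1 + ((δ - ρ) / 2 + (δ + ρ) / 2 * (p.1 / |p.1|)) ^ 2) * trial k δ ρ p ^ 2 with hG
  have hi := integrable_trial_sq hk hδ hρ
  have e1 : Set.EqOn G (fun p => k ^ 2 * (1 + δ ^ 2) * trial k δ ρ p ^ 2)
      (wedge T (Set.Ioi 0)) := fun p hp => by
    have hp' : 0 < p.1 := hp.1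
    simp only [hG, abs_of_pos hp', div_self hp'.ne']
    ring
  have m2 := measurableSet_wedge T (measurableSet_Iic (a := (0 : ℝ)))
  have e2 : G =ᵐ[volume.restrict (wedge T (Set.Iic 0))]
      fun p => k ^ 2 * (1 + ρ ^ 2) * trial k δ ρ p ^ 2 := by
    have h0 : ∀ᵐ d : ℝ, d ≠ 0 := by simp [ae_iff]
    have h1 : ∀ᵐ p : ℝ × ℝ, p.1 ≠ 0 := Measure.quasiMeasurePreserving_fst.ae h0
    filter_upwards [ae_restrict_mem m2, ae_restrict_of_ae h1] with p hp hp0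
    have hp' : p.1 ≤ 0 := hp.1
    simp only [hG, abs_of_nonpos hp', div_neg, div_self hp0]
    ring
  have m1 := measurableSet_wedge T (measurableSet_Ioi (a := (0 : ℝ)))
  rw [setIntegral_wedge_univ ((integrableOn_congr_fun e1 m1).2 (hi.const_mul _).integrableOn)
    ((hi.const_mul (k ^ 2 * (1 + ρ ^ 2))).integrableOn.congr e2.symm), setIntegral_congr_fun m1 e1,
    integral_congr_ae e2, integral_const_mul, integral_const_mul, integral_trial_pos hk hδ hρ hT,
    integral_trial_neg hk hδ hρ hT]
  field_simp

theorem Lam_denominator_ge {c : ℝ} (hc : 0 ≤ c) (hc1 : c ≤ 1) :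
    108 ≤ 108 + 180 * c - 132 * c ^ 2 + 45 * c ^ 3 - 5 * c ^ 4 := by
  have h2 : c ^ 2 ≤ c := by nlinarith
  have h4 : c ^ 4 ≤ c := by nlinarith [pow_le_one₀ hc hc1 (n := 3)]
  have h3 : 0 ≤ c ^ 3 := by positivity
  linarith

theorem Lam_eq (θ : ℝ) : Lam θ = 3 * (Real.cos θ ^ 2) ^ 3 *
    ((2 : ℝ) ^ (2 * Real.cos θ ^ 2) - 1) ^ 2 / (2 * (1 + 2 * Real.cos θ ^ 2) ^ 3 *
      (108 + 180 * Real.cos θ ^ 2 - 132 * (Real.cos θ ^ 2) ^ 2 + 45 * (Real.cos θ ^ 2) ^ 3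
        - 5 * (Real.cos θ ^ 2) ^ 4)) := by
  rw [Lam]
  ring_nf

theorem Lam_pos (hθ : θ ∈ Set.Ioo 0 (Real.pi / 2)) : 0 < Lam θ := by
  have hc := cos_pos_of_mem hθ
  have hc2 : 0 < Real.cos θ ^ 2 := by positivity
  have h1 : 1 < (2 : ℝ) ^ (2 * Real.cos θ ^ 2) :=
    Real.one_lt_rpow one_lt_two (by positivity)
  have h2 := Lam_denominator_ge hc2.le (Real.cos_sq_le_one θ)
  rw [Lam_eq]
  have h3 : 0 < (2 : ℝ) ^ (2 * Real.cos θ ^ 2) - 1 := by linarith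
  have h4 := lt_of_lt_of_le (by norm_num : (0 : ℝ) < 108) h2
  positivity

theorem Lam_le (θ : ℝ) : Lam θ ≤ (Real.cos θ ^ 2) ^ 3 / 216 := by
  rw [Lam_eq]
  set c := Real.cos θ ^ 2 with hc
  have hc0 : 0 ≤ c := sq_nonneg _
  have hc1 : c ≤ 1 := Real.cos_sq_le_one θ
  -- Bernoulli's inequality `4 ^ c ≤ 1 + 3 c`
  have h1 : (2 : ℝ) ^ (2 * c) - 1 ≤ 3 * c := by
    have h := rpow_one_add_le_one_add_mul_self (s := 3) (by norm_num) hc0 hc1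
    rw [Real.rpow_mul (by norm_num)]
    norm_num at h ⊢
    linarith
  have h0 : 0 ≤ (2 : ℝ) ^ (2 * c) - 1 := by
    have := Real.one_le_rpow (one_le_two (α := ℝ)) (by positivity : 0 ≤ 2 * c)
    linarith
  have h2 := Lam_denominator_ge hc0 hc1
  have h3 : ((2 : ℝ) ^ (2 * c) - 1) ^ 2 ≤ (3 * c) ^ 2 := pow_le_pow_left₀ h0 h1 2
  have h4 : 27 * c ^ 2 ≤ (1 + 2 * c) ^ 3 := by
    nlinarith [sq_nonneg (c - 1), mul_nonneg hc0 (sq_nonneg (c - 1))]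
  rw [div_le_div_iff₀ (by positivity) (by norm_num)]
  set P := 108 + 180 * c - 132 * c ^ 2 + 45 * c ^ 3 - 5 * c ^ 4
  calc 3 * c ^ 3 * ((2 : ℝ) ^ (2 * c) - 1) ^ 2 * 216 ≤ 3 * c ^ 3 * (3 * c) ^ 2 * 216 := by gcongr
    _ = c ^ 3 * (2 * (27 * c ^ 2) * 108) := by ring
    _ ≤ c ^ 3 * (2 * (1 + 2 * c) ^ 3 * P) := by gcongr

/-- The energy balance of the trial function with decay rates `δ = c² T / 4` and `ρ = 1 / T`,
where `T = tan θ` and `c = cos² θ`. -/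
theorem trial_balance {T c l : ℝ} (hT : 0 < T) (hc : c * (1 + T ^ 2) = 1) (hl : 0 < l)
    (hlc : l ≤ c ^ 3 / 216) :
    (1 + (c ^ 2 * T / 4) ^ 2) * (1 / (2 * (c ^ 2 * T / 4)) - 1 / (4 * (T + c ^ 2 * T / 4))) +
        (1 + (1 / T) ^ 2) * (1 / (4 * (T + 1 / T))) +
      (1 + 4 * l) * ((1 / (2 * (c ^ 2 * T / 4)) - 1 / (4 * (T + c ^ 2 * T / 4))) +
        1 / (4 * (T + 1 / T))) ≤ 1 / (c ^ 2 * T / 4) := by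
  have hc0 : 0 < c := pos_of_mul_pos_left (hc ▸ one_pos) (by positivity)
  have hc1 : c ≤ 1 := by nlinarith [mul_nonneg hc0.le (sq_nonneg T)]
  have hcT : c * T ^ 2 = 1 - c := by linarith
  set δ := c ^ 2 * T / 4 with hδ
  have hδ0 : 0 < δ := by positivity
  have eB : 1 / (4 * (T + 1 / T)) = c * T / 4 := by
    have : T + 1 / T = (1 + T ^ 2) / T := by field_simp; ring
    rw [this]
    field_simp
    linarith
  have eA : 1 / (4 * (T + δ)) = 1 / (T * (4 + c ^ 2)) := by rw [hδ]; congr 1; ring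
  -- estimates after multiplication by `T`, which leaves only powers of `c`
  have h1 : T * δ = c * (1 - c) / 4 := by rw [hδ, ← hcT]; ring
  have h2 : T * (l / δ) ≤ c / 54 := by
    have : T * (l / δ) = 4 * l / c ^ 2 := by rw [hδ]; field_simp
    rw [this, div_le_iff₀ (by positivity)]
    linarith
  have h3 : T * ((2 + (1 / T) ^ 2) * (c * T / 4)) = (2 - c) / 4 := by
    have : T * ((2 + (1 / T) ^ 2) * (c * T / 4)) = (2 * (c * T ^ 2) + c) / 4 := by field_simp
    rw [this, hcT]
    ring
  have h4 : T * (1 / (T * (4 + c ^ 2))) = 1 / (4 + c ^ 2) := by field_simp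
  have h5 : c * T / 4 ≤ 1 / (T * (4 + c ^ 2)) := by
    rw [le_div_iff₀ (by positivity)]
    have : c * T / 4 * (T * (4 + c ^ 2)) = (1 - c) * (4 + c ^ 2) / 4 := by rw [← hcT]; ring
    rw [this]
    nlinarith [pow_pos hc0 2, pow_pos hc0 3]
  have h6 : c * (1 - c) / 8 + c / 27 + (2 - c) / 4 ≤ 2 * (1 / (4 + c ^ 2)) := by
    rw [mul_one_div, le_div_iff₀ (by positivity)]
    nlinarith [pow_pos hc0 2, pow_pos hc0 3, pow_pos hc0 4, mul_pos hc0 hc0]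
  rw [eB, eA]
  set X := 1 / (T * (4 + c ^ 2)) with hX
  have hX0 : 0 < X := by positivity
  have h7 : T * (δ / 2 + 2 * (l / δ) + (2 + (1 / T) ^ 2) * (c * T / 4) - 2 * X) ≤ 0 := by
    linarith
  have h8 : δ / 2 + 2 * (l / δ) + (2 + (1 / T) ^ 2) * (c * T / 4) - 2 * X ≤ 0 :=
    nonpos_of_mul_nonpos_right h7 hT
  have h9 : 4 * l * (c * T / 4) ≤ 4 * l * X := by gcongr
  have h10 : 0 ≤ δ ^ 2 * X := by positivity
  have e1 : (1 + δ ^ 2) * (1 / (2 * δ)) + (1 + 4 * l) * (1 / (2 * δ)) =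
      1 / δ + δ / 2 + 2 * (l / δ) := by field_simp; ring
  linarith

/-- The trial function shows that the infimum of the form is at most `-α² (1/4 + Λ(θ))`. -/
theorem groundEnergy_le_Lam (hθ : θ ∈ Set.Ioo 0 (Real.pi / 2)) {α : ℝ} (hα : 0 < α) :
    groundEnergy hθ α ≤ -α ^ 2 * (1 / 4 + Lam θ) := by
  set T := Real.tan θ with hT
  set c := Real.cos θ ^ 2 with hc
  set k := α / 2 with hk
  have hT0 : 0 < T := tan_pos_of_mem hθ
  have hcos := cos_pos_of_mem hθ
  have hc0 : 0 < c := by positivity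
  have hk0 : 0 < k := by positivity
  set δ := c ^ 2 * T / 4 with hδ
  set ρ := 1 / T with hρ
  have hδ0 : 0 < δ := by positivity
  have hρ0 : 0 < ρ := by positivity
  have hcT : c * (1 + T ^ 2) = 1 := by
    rw [hT, hc, Real.tan_eq_sin_div_cos]
    field_simp
    linarith [Real.sin_sq_add_cos_sq θ]
  have hbal := trial_balance hT0 hcT (Lam_pos hθ) (Lam_le θ)
  rw [← hδ, ← hρ] at hbal
  set W := (1 / (2 * δ) - 1 / (4 * (T + δ))) + 1 / (4 * (T + ρ)) with hW
  have hW0 : 0 < W := by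
    have : 1 / (2 * δ) - 1 / (4 * (T + δ)) = (2 * T + δ) / (4 * δ * (T + δ)) := by
      field_simp; ring
    rw [hW, this]
    positivity
  have hi := integrable_trial_sq hk0 hδ0 hρ0
  have hlim := le_of_tendsto_of_tendsto'
    ((tendsto_norm_approxTest hθ hk0 hδ0 hρ0).const_mul (groundEnergy hθ α))
    ((tendsto_kinetic_approxTest hθ hk0 hδ0 hρ0).sub
      ((tendsto_trace_approxTest hθ hk0 hδ0 hρ0).const_mul α))
    fun n => groundEnergy_le hθ hα (approxTest θ k δ ρ n)
  rw [setIntegral_wedge_univ hi.integrableOn hi.integrableOn, integral_trial_pos hk0 hδ0 hρ0 hT0,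
    integral_trial_neg hk0 hδ0 hρ0 hT0, integral_kinetic_trial hk0 hδ0 hρ0 hT0,
    integral_trace_trial hk0 hδ0, ← add_div, ← hW] at hlim
  have e1 : α * (2 * (1 / (2 * k * δ))) = 2 * (1 / δ) := by rw [hk]; field_simp
  rw [e1] at hlim
  have h1 : groundEnergy hθ α * (2 * (W / k ^ 2)) ≤
      -α ^ 2 * (1 / 4 + Lam θ) * (2 * (W / k ^ 2)) := by
    have e2 : -α ^ 2 * (1 / 4 + Lam θ) * (2 * (W / k ^ 2)) = -2 * ((1 + 4 * Lam θ) * W) := by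
      rw [hk]; field_simp; ring
    rw [e2]
    linarith
  exact le_of_mul_le_mul_right h1 (by positivity)

end

/-! ### The operator and its lowest eigenvalue -/

section

variable {θ : ℝ}

/-- The bilinear integral pairing of `L²` as an inner product. -/
theorem integral_mul_eq_inner (u : L2Plane) {f : Plane → ℂ} (hf : MemLp f 2 volume) :
    ∫ x, u x * f x = inner ℂ (hf.star.toLp (star f)) u := by
  rw [L2.inner_def]
  refine integral_congr_ae ?_
  filter_upwards [hf.star.coeFn_toLp] with x hx
  rw [hx]
  simp [RCLike.inner_apply]

/-- An element of `L²(ℝ²)` that annihilates all real test functions vanishes. -/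
theorem eq_zero_of_integral_test {f : L2Plane}
    (h : ∀ g : Plane → ℝ, IsTest (fun x => (g x : ℂ)) → ∫ x, f x * (g x : ℂ) = 0) : f = 0 := by
  rw [Lp.eq_zero_iff_ae_eq_zero]
  refine ae_eq_zero_of_integral_contDiff_smul_eq_zero
    ((Lp.memLp f).locallyIntegrable (by norm_num)) fun g hg hc => ?_
  have ht : IsTest fun x => (g x : ℂ) :=
    ⟨Complex.ofRealCLM.contDiff.comp hg, hc.comp_left (g := fun t : ℝ => (t : ℂ)) rfl⟩
  rw [← h g ht]
  refine integral_congr_ae (ae_of_all _ fun x => ?_)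
  simp [mul_comm]

theorem isTrace_iff (hθ : θ ∈ Set.Ioo 0 (Real.pi / 2)) {u : L2Plane} {G : Fin 2 → L2Plane}
    {τ : L2Line θ} : IsTrace θ u G τ ↔ ∃ φ : ℕ → testSpace,
      Tendsto (fun n => toL2 (φ n)) atTop (𝓝 u) ∧
      (∀ j, Tendsto (fun n => gradL2 j (φ n)) atTop (𝓝 (G j))) ∧
      Tendsto (fun n => traceL2 hθ (φ n)) atTop (𝓝 τ) := by
  have key : ∀ {μ : Measure Plane} (f : ℕ → Plane → ℂ) (hf : ∀ n, MemLp (f n) 2 μ) (g : Lp ℂ 2 μ),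
      Tendsto (fun n => (hf n).toLp (f n)) atTop (𝓝 g) ↔
        Tendsto (fun n => eLpNorm (fun x => f n x - g x) 2 μ) atTop (𝓝 0) := by
    intro μ f hf g
    have := Lp.tendsto_Lp_iff_tendsto_eLpNorm'' (fi := atTop) f hf g (Lp.memLp g)
    rwa [Lp.toLp_coeFn] at this
  constructor
  · rintro ⟨φ, hφ, h1, h2, h3⟩
    exact ⟨fun n => ⟨φ n, hφ n⟩, (key φ (fun n => (hφ n).memLp) u).2 h1,
      fun j => (key _ (fun n => (hφ n).memLp_pderiv j) (G j)).2 (h2 j),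
      (key φ (fun n => (hφ n).memLp_arcLength hθ) τ).2 h3⟩
  · rintro ⟨φ, h1, h2, h3⟩
    exact ⟨fun n => φ n, fun n => (φ n).2, (key _ (fun n => IsTest.memLp (φ n).2) u).1 h1,
      fun j => (key _ (fun n => IsTest.memLp_pderiv (φ n).2 j) (G j)).1 (h2 j),
      (key _ (fun n => IsTest.memLp_arcLength (φ n).2 hθ) τ).1 h3⟩

theorem integral_mul_pderiv (φ : testSpace) {χ : Plane → ℂ} (hχ : IsTest χ) (j : Fin 2) :
    ∫ x, φ.1 x * pderiv j χ x = -∫ x, pderiv j φ x * χ x := by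
  have hφ : IsTest φ.1 := φ.2
  have hi : ∀ {f g : Plane → ℂ}, MemLp f 2 volume → MemLp g 2 volume →
      Integrable fun x => f x * g x := fun hf hg => hf.integrable_mul hg
  exact integral_mul_fderiv_eq_neg_fderiv_mul_of_integrable
    (hi (hφ.memLp_pderiv j) hχ.memLp) (hi hφ.memLp (hχ.memLp_pderiv j)) (hi hφ.memLp hχ.memLp)
    (fun x _ => hφ.differentiable x) (fun x _ => hχ.differentiable x)

/-- Limits of test functions in `H¹(ℝ²)` have weak gradients, and the limits of the restrictions
to `Γ` are their traces. -/
theorem inFormDomain_iff (hθ : θ ∈ Set.Ioo 0 (Real.pi / 2)) {u : L2Plane} {G : Fin 2 → L2Plane}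
    {τ : L2Line θ} : InFormDomain θ u G τ ↔ ∃ φ : ℕ → testSpace,
      Tendsto (fun n => toL2 (φ n)) atTop (𝓝 u) ∧
      (∀ j, Tendsto (fun n => gradL2 j (φ n)) atTop (𝓝 (G j))) ∧
      Tendsto (fun n => traceL2 hθ (φ n)) atTop (𝓝 τ) := by
  rw [InFormDomain, isTrace_iff hθ, and_iff_right_iff_imp]
  rintro ⟨φ, h1, h2, -⟩ j χ hχ
  rw [integral_mul_eq_inner u (hχ.memLp_pderiv j), integral_mul_eq_inner (G j) hχ.memLp]
  have h3 := (tendsto_const_nhds (x := (hχ.memLp_pderiv j).star.toLp (star (pderiv j χ)))).inner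
    (𝕜 := ℂ) h1
  have h4 := ((tendsto_const_nhds (x := hχ.memLp.star.toLp (star χ))).inner (𝕜 := ℂ) (h2 j)).neg
  refine tendsto_nhds_unique h3 (h4.congr fun n => ?_)
  rw [← integral_mul_eq_inner _ (hχ.memLp_pderiv j), ← integral_mul_eq_inner _ hχ.memLp]
  have e1 : ∫ x, toL2 (φ n) x * pderiv j χ x = ∫ x, (φ n).1 x * pderiv j χ x := by
    refine integral_congr_ae ?_
    filter_upwards [(IsTest.memLp (φ n).2).coeFn_toLp] with x hx
    exact congrArg (· * _) hx
  have e2 : ∫ x, gradL2 j (φ n) x * χ x = ∫ x, pderiv j (φ n) x * χ x := by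
    refine integral_congr_ae ?_
    filter_upwards [(IsTest.memLp_pderiv (φ n).2 j).coeFn_toLp] with x hx
    exact congrArg (· * _) hx
  rw [e1, e2, integral_mul_pderiv (φ n) hχ]

theorem inFormDomain_test (hθ : θ ∈ Set.Ioo 0 (Real.pi / 2)) (φ : testSpace) :
    InFormDomain θ (toL2 φ) (fun j => gradL2 j φ) (traceL2 hθ φ) :=
  (inFormDomain_iff hθ).2
    ⟨fun _ => φ, tendsto_const_nhds, fun _ => tendsto_const_nhds, tendsto_const_nhds⟩

/-- The weak gradient and the trace are determined by the function. -/
theorem InFormDomain.eq_zero (hθ : θ ∈ Set.Ioo 0 (Real.pi / 2)) {G : Fin 2 → L2Plane}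
    {τ : L2Line θ} (h : InFormDomain θ 0 G τ) : G = 0 ∧ τ = 0 := by
  have hG : G = 0 := by
    funext j
    refine eq_zero_of_integral_test fun g hg => ?_
    have h1 := h.1 j _ hg
    have h2 : ∫ x, (0 : L2Plane) x * pderiv j (fun x => (g x : ℂ)) x = 0 := by
      rw [integral_mul_eq_inner _ (hg.memLp_pderiv j), inner_zero_right]
    rw [h2] at h1
    exact neg_eq_zero.1 h1.symm
  refine ⟨hG, ?_⟩
  obtain ⟨φ, h1, h2, h3⟩ := (inFormDomain_iff hθ).1 h
  have h4 : Tendsto (fun n => kinetic (φ n) + ‖toL2 (φ n)‖ ^ 2) atTop (𝓝 0) := by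
    have h5 := (tendsto_finsetSum Finset.univ fun j _ => ((h2 j).norm.pow 2)).add (h1.norm.pow 2)
    simpa [hG, kinetic] using h5
  have h6 : Tendsto (fun n => ‖traceL2 hθ (φ n)‖ ^ 2) atTop (𝓝 0) := by
    refine squeeze_zero (fun _ => sq_nonneg _) (fun n => ?_) h4
    simpa using trace_inequality hθ one_pos (φ n)
  have h7 := tendsto_nhds_unique (h3.norm.pow 2) h6
  simpa using h7

/-- The operator is well defined: its graph contains no `(0, f)` with `f ≠ 0`. -/
theorem operatorGraph_single_valued (hθ : θ ∈ Set.Ioo 0 (Real.pi / 2)) (α : ℝ) :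
    ∀ p ∈ operatorGraph θ α, p.1 = 0 → p.2 = 0 := by
  rintro ⟨u, f⟩ ⟨G, τ, hu, hf⟩ (rfl : u = 0)
  obtain ⟨rfl, rfl⟩ := InFormDomain.eq_zero hθ hu
  refine eq_zero_of_integral_test fun g hg => ?_
  have h1 := hf _ _ _ (inFormDomain_test hθ ⟨_, hg⟩)
  rw [form] at h1
  simp only [Pi.zero_apply, inner_zero_right, Finset.sum_const_zero, mul_zero, sub_zero] at h1
  rw [integral_mul_eq_inner f hg.memLp, h1]
  congr 1
  refine MemLp.toLp_congr _ hg.memLp (ae_of_all _ fun x => ?_)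
  simp

theorem mem_eigenvalues_iff (hθ : θ ∈ Set.Ioo 0 (Real.pi / 2)) (α E : ℝ) :
    E ∈ eigenvalues θ α ↔ ∃ u : L2Plane, u ≠ 0 ∧ (u, (E : ℂ) • u) ∈ operatorGraph θ α := by
  have hg := Submodule.toLinearPMap_graph_eq _ (operatorGraph_single_valued hθ α)
  constructor
  · rintro ⟨u, hu, h⟩
    refine ⟨u, fun h0 => hu (Subtype.ext h0), ?_⟩
    rw [← hg, ← h]
    exact LinearPMap.mem_graph _ u
  · rintro ⟨u, hu, h⟩
    rw [← hg, LinearPMap.mem_graph_iff] at h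
    obtain ⟨y, hy, h⟩ := h
    simp only at hy h
    subst hy
    exact ⟨y, fun h0 => hu (by rw [h0]; rfl), h⟩

theorem groundEnergy_le_form (hθ : θ ∈ Set.Ioo 0 (Real.pi / 2)) {α : ℝ} (hα : 0 < α)
    {u : L2Plane} {G : Fin 2 → L2Plane} {τ : L2Line θ} (h : InFormDomain θ u G τ) :
    groundEnergy hθ α * ‖u‖ ^ 2 ≤ (∑ j, ‖G j‖ ^ 2) - α * ‖τ‖ ^ 2 := by
  obtain ⟨φ, h1, h2, h3⟩ := (inFormDomain_iff hθ).1 h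
  exact le_of_tendsto_of_tendsto' ((h1.norm.pow 2).const_mul _)
    ((tendsto_finsetSum Finset.univ fun j _ => ((h2 j).norm.pow 2)).sub
      ((h3.norm.pow 2).const_mul α)) fun n => groundEnergy_le hθ hα (φ n)

/-- A minimizer of the Rayleigh quotient satisfies the Euler–Lagrange equation. -/
theorem form_eq_of_minimizer (hθ : θ ∈ Set.Ioo 0 (Real.pi / 2)) {α : ℝ} (hα : 0 < α)
    {u : L2Plane} {G : Fin 2 → L2Plane} {τ : L2Line θ} (h : InFormDomain θ u G τ)
    (hmin : (∑ j, ‖G j‖ ^ 2) - α * ‖τ‖ ^ 2 = groundEnergy hθ α * ‖u‖ ^ 2)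
    {v : L2Plane} {Gv : Fin 2 → L2Plane} {τv : L2Line θ} (hv : InFormDomain θ v Gv τv) :
    form θ α Gv τv G τ = (groundEnergy hθ α : ℂ) * inner ℂ v u := by
  set E := groundEnergy hθ α with hE
  set w : ℂ := form θ α G τ Gv τv - E * inner ℂ u v with hw
  set b : ℝ := (∑ j, ‖Gv j‖ ^ 2) - α * ‖τv‖ ^ 2 - E * ‖v‖ ^ 2 with hb
  have hb0 : 0 ≤ b := sub_nonneg.2 (groundEnergy_le_form hθ hα hv)
  have hexp : ∀ {F : Type} [NormedAddCommGroup F] [InnerProductSpace ℂ F] (x y : F) (z : ℂ),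
      ‖x + z • y‖ ^ 2 = ‖x‖ ^ 2 + 2 * (z * inner ℂ x y).re + ‖z‖ ^ 2 * ‖y‖ ^ 2 := by
    intro F _ _ x y z
    rw [norm_add_sq (𝕜 := ℂ), inner_smul_right, norm_smul, mul_pow]
    rfl
  have hquad : ∀ z : ℂ, 0 ≤ 2 * (z * w).re + ‖z‖ ^ 2 * b := by
    intro z
    have h1 := groundEnergy_le_form hθ hα (h.add (hv.smul z))
    simp only [Pi.add_apply, Pi.smul_apply, hexp, Fin.sum_univ_two] at h1
    simp only [Fin.sum_univ_two] at hmin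
    have h2 : (z * w).re = (z * inner ℂ (G 0) (Gv 0)).re + (z * inner ℂ (G 1) (Gv 1)).re -
        α * (z * inner ℂ τ τv).re - E * (z * inner ℂ u v).re := by
      rw [hw, form, Fin.sum_univ_two, ← Complex.re_ofReal_mul, ← Complex.re_ofReal_mul,
        ← Complex.add_re, ← Complex.sub_re, ← Complex.sub_re]
      congr 1
      ring
    rw [h2, hb, Fin.sum_univ_two]
    rw [← hE] at h1
    linarith
  have hw0 : w = 0 := by
    by_contra hne
    have h0 : 0 < ‖w‖ ^ 2 := by positivity
    -- the minimum over `t` of `t² b - 2 t` is negative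
    have h1 := hquad (-(((b + 1)⁻¹ : ℝ) : ℂ) * starRingEnd ℂ w)
    have h2 : -(((b + 1)⁻¹ : ℝ) : ℂ) * starRingEnd ℂ w * w =
        ((-(b + 1)⁻¹ * ‖w‖ ^ 2 : ℝ) : ℂ) := by
      rw [mul_assoc, mul_comm (starRingEnd ℂ w), Complex.mul_conj, Complex.normSq_eq_norm_sq]
      push_cast
      ring
    have hb1 : 0 < b + 1 := by linarith
    rw [h2, Complex.ofReal_re, norm_mul, norm_neg, Complex.norm_real, RCLike.norm_conj,
      Real.norm_of_nonneg (by positivity)] at h1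
    have h3 : 2 * (-(b + 1)⁻¹ * ‖w‖ ^ 2) + ((b + 1)⁻¹ * ‖w‖) ^ 2 * b =
        -((b + 1)⁻¹ ^ 2 * ‖w‖ ^ 2 * (b + 2)) := by
      field_simp
      ring
    rw [h3] at h1
    have : 0 < (b + 1)⁻¹ ^ 2 * ‖w‖ ^ 2 * (b + 2) := by positivity
    linarith
  have hconj := congrArg (starRingEnd ℂ) hw0
  rw [hw, form] at hconj
  simp only [map_sub, map_sum, map_mul, inner_conj_symm, Complex.conj_ofReal, map_zero] at hconj
  rw [form]
  linear_combination hconj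

/-- If the infimum of the form lies below `-α² / 4`, it is the lowest eigenvalue. -/
theorem isLeast_eigenvalues (hθ : θ ∈ Set.Ioo 0 (Real.pi / 2)) {α : ℝ} (hα : 0 < α)
    (hlt : groundEnergy hθ α < -(α / 2) ^ 2) :
    IsLeast (eigenvalues θ α) (groundEnergy hθ α) := by
  constructor
  · obtain ⟨φ, hφ1, hconv, hJ, hD, hR⟩ := exists_cauchy_minimizing hθ hα hlt
    obtain ⟨u, hu⟩ := cauchySeq_tendsto_of_complete hJ
    choose G hG using fun j => cauchySeq_tendsto_of_complete (hD j)
    obtain ⟨τ, hτ⟩ := cauchySeq_tendsto_of_complete hR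
    have hdom : InFormDomain θ u G τ := (inFormDomain_iff hθ).2 ⟨φ, hu, hG, hτ⟩
    have hnorm : ‖u‖ = 1 := by
      refine tendsto_nhds_unique hu.norm ?_
      simp only [hφ1]
      exact tendsto_const_nhds
    have hen : (∑ j, ‖G j‖ ^ 2) - α * ‖τ‖ ^ 2 = groundEnergy hθ α * ‖u‖ ^ 2 := by
      rw [hnorm, one_pow, mul_one]
      exact tendsto_nhds_unique
        ((tendsto_finsetSum Finset.univ fun j _ => ((hG j).norm.pow 2)).sub
          ((hτ.norm.pow 2).const_mul α)) hconv
    refine (mem_eigenvalues_iff hθ α _).2 ⟨u, ?_, G, τ, hdom, fun v Gv τv hv => ?_⟩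
    · rintro rfl
      simp at hnorm
    · rw [inner_smul_right]
      exact form_eq_of_minimizer hθ hα hdom hen hv
  · intro e he
    obtain ⟨u, hu, G, τ, hdom, h⟩ := (mem_eigenvalues_iff hθ α e).1 he
    have h1 := h u G τ hdom
    have h2 := groundEnergy_le_form hθ hα hdom
    have h3 : (∑ j, ‖G j‖ ^ 2) - α * ‖τ‖ ^ 2 = e * ‖u‖ ^ 2 := by
      rw [form, inner_smul_right] at h1
      simp only [inner_self_eq_norm_sq_to_K] at h1
      apply Complex.ofReal_injective
      push_cast
      exact h1
    rw [h3] at h2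
    exact le_of_mul_le_mul_right h2 (by have := norm_pos_iff.2 hu; positivity)

end

end BrokenLine

end

/-- For a broken line with half-angle `θ ∈ (0, π/2)` and coupling constant `α > 0`, the operator
`H(θ, α)` has a lowest eigenvalue `lam`, and it is at most `-α² (1/4 + Λ(θ))`, where `Λ(θ)` is
strictly positive. -/
theorem theorem2 (θ α : ℝ) (hθ : θ ∈ Set.Ioo 0 (Real.pi / 2)) (hα : 0 < α) :
    0 < BrokenLine.Lam θ ∧
    ∃ lam : ℝ, IsLeast (BrokenLine.eigenvalues θ α) lam ∧
      lam ≤ -α ^ 2 * (1 / 4 + BrokenLine.Lam θ) := by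
  have hpos := BrokenLine.Lam_pos hθ
  have hle := BrokenLine.groundEnergy_le_Lam hθ hα
  refine ⟨hpos, BrokenLine.groundEnergy hθ α, BrokenLine.isLeast_eigenvalues hθ hα ?_, hle⟩
  have := mul_pos (pow_pos hα 2) hpos
  linarith
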